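/- For a matrix $T\in\{0,1\}^{n\times\ell}$ let $\gamma(T)=\min_{i\neq i'} d(T[i],T[i'])$ and $\delta(T)=\max_{i\neq i'} d(T[i],T[i'])$, where $T[i]$ is the $i$-th row of $T$ and $d$ is the Hamming distance (if $n\le 1$, then $\gamma(T)=\infty$ and $\delta(T)=0$). A completion of a matrix $S\in\{0,1,\square\}^{n\times\ell}$ is a matrix $T\in\{0,1\}^{n\times\ell}$ that agrees with $S$ at every entry of $S$ other than the missing entries $\square$. The problem Diameter Matrix Completion (DMC) asks, given $S\in\{0,1,\square\}^{n\times\ell}$ and integers $0\le\alpha\le\beta$, whether $S$ has a completion $T$ with $\alpha\le\gamma(T)$ and $\delta(T)\le\beta$. Theorem. DMC, with $\alpha$ and $\beta$ part of the input, can be solved in $O(n^2\ell)$ time on inputs $S$ in which every row has at most one missing entry. Here time is the number of steps on a word RAM: there are a single program and constants $C,c$ such that, for all $n,\ell\ge 0$, all $0\le\alpha\le\beta$ and all such $S$, and for every word length $w\ge c\log_2(n+\ell+\alpha+\beta+2)$, the program started on $(n,\ell,\alpha,\beta,S)$ halts after at most $C\,(n^2\ell+1)$ steps with output $1$ if $(S,\alpha,\beta)$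 is a yes-instance of DMC and with output $0$ otherwise. (The summand $1$ matters only for $n=0$ or $\ell=0$.) -/

import Mathlib

/-! ## Diameter matrix completion -/

namespace DMC

/-- A matrix with entries in `{0, 1, □}`; `none` is the missing entry `□`. -/
abbrev IncompleteMatrix (n l : ℕ) : Type := Matrix (Fin n) (Fin l) (Option Bool)

/-- `T` is a completion of `S`: it agrees with `S` at every entry that is not missing. -/
def IsCompletion {n l : ℕ} (S : IncompleteMatrix n l) (T : Matrix (Fin n) (Fin l) Bool) : Prop :=
  ∀ i j, S i j = none ∨ S i j = some (T i j)

/-- The minimum Hamming distance of two distinct rows (`⊤` if there are no two distinct rows). -/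
noncomputable def gamma {n l : ℕ} (T : Matrix (Fin n) (Fin l) Bool) : ℕ∞ :=
  ⨅ (i : Fin n) (i' : Fin n) (_ : i ≠ i'), (hammingDist (T i) (T i') : ℕ∞)

/-- The maximum Hamming distance of two distinct rows (`0` if there are no two distinct rows). -/
noncomputable def delta {n l : ℕ} (T : Matrix (Fin n) (Fin l) Bool) : ℕ∞ :=
  ⨆ (i : Fin n) (i' : Fin n) (_ : i ≠ i'), (hammingDist (T i) (T i') : ℕ∞)

/-- `(S, α, β)` is a yes-instance of Diameter Matrix Completion. -/
def IsYes {n l : ℕ} (S : IncompleteMatrix n l) (α β : ℕ) : Prop :=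
  ∃ T : Matrix (Fin n) (Fin l) Bool, IsCompletion S T ∧ (α : ℕ∞) ≤ gamma T ∧ delta T ≤ (β : ℕ∞)

/-- Every row has at most `k` missing entries. -/
def MissingPerRowLE {n l : ℕ} (S : IncompleteMatrix n l) (k : ℕ) : Prop :=
  ∀ i, (Finset.univ.filter fun j => S i j = none).card ≤ k

end DMC

/-! ## The word RAM

A program is a finite list of instructions. It works on registers `R[0], R[1], …` (finitely many
of them are named by a given program) and on a random-access memory `M`. All computed values are
words, that is, numbers below `2 ^ w`: `const`, `add` and `mul` work modulo `2 ^ w`. One executed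
instruction is one step. The machine halts when the program counter leaves the program. -/

namespace WordRAM

inductive Instr : Type
  /-- `R[d] := k` -/
  | const (d k : ℕ)
  /-- `R[d] := R[a]` -/
  | move (d a : ℕ)
  /-- `R[d] := R[a] + R[b]` -/
  | add (d a b : ℕ)
  /-- `R[d] := R[a] - R[b]`, which is `0` if `R[a] < R[b]` -/
  | sub (d a b : ℕ)
  /-- `R[d] := R[a] * R[b]` -/
  | mul (d a b : ℕ)
  /-- `R[d] := M[R[a]]` -/
  | load (d a : ℕ)
  /-- `M[R[a]] := R[b]` -/
  | store (a b : ℕ)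
  /-- `goto t` -/
  | jump (t : ℕ)
  /-- `if R[a] = R[b] then goto t` -/
  | jeq (a b t : ℕ)
  /-- `if R[a] < R[b] then goto t` -/
  | jlt (a b t : ℕ)

abbrev Program : Type := List Instr

structure State : Type where
  pc : ℕ
  reg : ℕ → ℕ
  mem : ℕ → ℕ

/-- Write `v` to the register `d` and go to the next instruction. -/
def State.write (s : State) (d v : ℕ) : State :=
  ⟨s.pc + 1, Function.update s.reg d v, s.mem⟩

/-- The effect of one instruction on a machine with words of `w` bits. -/
def Instr.exec (w : ℕ) (s : State) : Instr → State
  | .const d k => s.write d (k % 2 ^ w)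
  | .move d a => s.write d (s.reg a)
  | .add d a b => s.write d ((s.reg a + s.reg b) % 2 ^ w)
  | .sub d a b => s.write d (s.reg a - s.reg b)
  | .mul d a b => s.write d ((s.reg a * s.reg b) % 2 ^ w)
  | .load d a => s.write d (s.mem (s.reg a))
  | .store a b => ⟨s.pc + 1, s.reg, Function.update s.mem (s.reg a) (s.reg b)⟩
  | .jump t => ⟨t, s.reg, s.mem⟩
  | .jeq a b t => ⟨if s.reg a = s.reg b then t else s.pc + 1, s.reg, s.mem⟩
  | .jlt a b t => ⟨if s.reg a < s.reg b then t else s.pc + 1, s.reg, s.mem⟩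

/-- One step of the machine; halted states stay as they are. -/
def step (w : ℕ) (P : Program) (s : State) : State :=
  match P[s.pc]? with
  | none => s
  | some I => I.exec w s

/-- Started in `s`, the program halts after at most `T` steps, with `out` in the register `0`. -/
def HaltsWithin (w : ℕ) (P : Program) (s : State) (T out : ℕ) : Prop :=
  ∃ t ≤ T, P.length ≤ ((step w P)^[t] s).pc ∧ ((step w P)^[t] s).reg 0 = out

end WordRAM

namespace DMC

/-- The word that stands for an entry: `0`, `1`, and `2` for a missing entry. -/
def entryCode : Option Bool → ℕ
  | some false => 0
  | some true => 1
  | none => 2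

/-- The initial state for the input `(S, α, β)`: the registers `0, 1, 2, 3` hold `n, ℓ, α, β`, the
memory cells `0, …, n * ℓ - 1` hold the entries of `S` row by row, and all else is `0`. -/
def initialState {n l : ℕ} (S : IncompleteMatrix n l) (α β : ℕ) : WordRAM.State where
  pc := 0
  reg := fun r => match r with
    | 0 => n
    | 1 => l
    | 2 => α
    | 3 => β
    | _ => 0
  mem := fun a => if h : a < n * l then
      entryCode (S (Fin.divNat (⟨a, h⟩ : Fin (n * l))) (Fin.modNat (⟨a, h⟩ : Fin (n * l))))
    else 0

end DMC

/-! ## A structured language for the word RAM -/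

namespace WordRAM

/-! A row with one missing entry has two fillings and a row without missing entries has one, so a
completion amounts to one Boolean value per row. Two rows with chosen values either respect the
bounds `α` and `β` or violate them. The problem is therefore a system of binary constraints, an
instance of 2-SAT with `n` variables (`isYes_iff`). A constraint is tested when needed by computing
a Hamming distance in time `O(ℓ)`, so propagating one value to all other variables takes time
`O(nℓ)`.

The system is solved by guessing and unit propagation with limited backtracking. If the assigned
values are closed under propagation, then any solution can be overwritten by them and remains a
solution (`Closed.exists_agrees`). Hence a closed partial assignment never needs revision, and if
both values of a further variable lead to a contradiction, there is no solution at all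
(`Closed.not_exists_isSolution`).

A failing guess could waste many propagations. The two guesses therefore run in lock-step on two
copies of the assignment, one propagated variable per copy and round, until one copy is closed or
both are contradictory. A success after `k` rounds has propagated `k - 1` further variables, and
these are kept. This gives `O(n)` rounds of cost `O(nℓ)` in total. Copying adds `O(n)` per variable,
which is absorbed if `ℓ ≥ 1`; the case `ℓ = 0` is decided separately in constant time.

At machine level, a small structured language has weakest preconditions that carry a clock and
exclude overflow. By `wp_sound`, each such precondition yields an actual run whose length is the
elapsed clock time. -/

/-- Structured commands; they are compiled to word RAM code. -/
inductive Cmd : Type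
  | skip
  | const (d k : ℕ)
  | move (d a : ℕ)
  | add (d a b : ℕ)
  | sub (d a b : ℕ)
  | mul (d a b : ℕ)
  | load (d a : ℕ)
  | store (a b : ℕ)
  | seq (c e : Cmd)
  | ifEq (a b : ℕ) (c e : Cmd)
  | ifLt (a b : ℕ) (c e : Cmd)
  | whileNe (a b : ℕ) (c : Cmd)

infixr:60 " ;; " => Cmd.seq

/-- The number of instructions of the compiled command. -/
def Cmd.size : Cmd → ℕ
  | .skip => 0
  | .seq c e => c.size + e.size
  | .ifEq _ _ c e => e.size + c.size + 2
  | .ifLt _ _ c e => e.size + c.size + 2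
  | .whileNe _ _ c => c.size + 2
  | _ => 1

/-- The code of a command that is placed at the address `k`. -/
def Cmd.compile (k : ℕ) : Cmd → Program
  | .skip => []
  | .const d v => [.const d v]
  | .move d a => [.move d a]
  | .add d a b => [.add d a b]
  | .sub d a b => [.sub d a b]
  | .mul d a b => [.mul d a b]
  | .load d a => [.load d a]
  | .store a b => [.store a b]
  | .seq c e => c.compile k ++ e.compile (k + c.size)
  | .ifEq a b c e => .jeq a b (k + e.size + 2) ::
      (e.compile (k + 1) ++ .jump (k + e.size + c.size + 2) :: c.compile (k + e.size + 2))
  | .ifLt a b c e => .jlt a b (k + e.size + 2) ::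
      (e.compile (k + 1) ++ .jump (k + e.size + c.size + 2) :: c.compile (k + e.size + 2))
  | .whileNe a b c => .jeq a b (k + c.size + 2) :: (c.compile (k + 1) ++ [.jump k])

theorem Cmd.length_compile (c : Cmd) (k : ℕ) : (c.compile k).length = c.size := by
  induction c generalizing k <;> simp [Cmd.compile, Cmd.size, *] <;> omega

/-! ### Weakest preconditions with running time -/

/-- Registers, memory, and a clock that counts the executed instructions. -/
structure Cfg : Type where
  reg : ℕ → ℕ
  mem : ℕ → ℕ
  clk : ℕ

/-- Let one unit of time pass. -/
def Cfg.tick (s : Cfg) : Cfg := ⟨s.reg, s.mem, s.clk + 1⟩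

/-- Write a register, in one unit of time. -/
def Cfg.set (s : Cfg) (d v : ℕ) : Cfg := ⟨Function.update s.reg d v, s.mem, s.clk + 1⟩

/-- Write a memory cell, in one unit of time. -/
def Cfg.put (s : Cfg) (a v : ℕ) : Cfg := ⟨s.reg, Function.update s.mem a v, s.clk + 1⟩

/-- The loop `while R[a] ≠ R[b]` with a body of the given weakest precondition reaches `Q` after at
most the given number of rounds. -/
def loopWp (a b : ℕ) (body : (Cfg → Prop) → Cfg → Prop) (Q : Cfg → Prop) : ℕ → Cfg → Prop
  | 0, _ => False
  | N + 1, s => if s.reg a = s.reg b then Q s.tick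
      else body (fun s' => loopWp a b body Q N s'.tick) s.tick

/-- Weakest precondition: started in `s`, the command terminates without overflow in a
configuration that satisfies `Q`. -/
def wp (w : ℕ) : Cmd → (Cfg → Prop) → Cfg → Prop
  | .skip, Q, s => Q s
  | .const d k, Q, s => k < 2 ^ w ∧ Q (s.set d k)
  | .move d a, Q, s => Q (s.set d (s.reg a))
  | .add d a b, Q, s => s.reg a + s.reg b < 2 ^ w ∧ Q (s.set d (s.reg a + s.reg b))
  | .sub d a b, Q, s => Q (s.set d (s.reg a - s.reg b))
  | .mul d a b, Q, s => s.reg a * s.reg b < 2 ^ w ∧ Q (s.set d (s.reg a * s.reg b))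
  | .load d a, Q, s => Q (s.set d (s.mem (s.reg a)))
  | .store a b, Q, s => Q (s.put (s.reg a) (s.reg b))
  | .seq c e, Q, s => wp w c (wp w e Q) s
  | .ifEq a b c e, Q, s => if s.reg a = s.reg b then wp w c Q s.tick
      else wp w e (fun s' => Q s'.tick) s.tick
  | .ifLt a b c e, Q, s => if s.reg a < s.reg b then wp w c Q s.tick
      else wp w e (fun s' => Q s'.tick) s.tick
  | .whileNe a b c, Q, s => ∃ N, loopWp a b (wp w c) Q N s

theorem loopWp_mono {a b : ℕ} {body : (Cfg → Prop) → Cfg → Prop}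
    (hb : ∀ (Q Q' : Cfg → Prop) s, (∀ s', Q s' → Q' s') → body Q s → body Q' s)
    {Q Q' : Cfg → Prop} (h : ∀ s', Q s' → Q' s') :
    ∀ {N s}, loopWp a b body Q N s → loopWp a b body Q' N s
  | 0, _, h' => h'
  | N + 1, s, h' => by
    unfold loopWp at h' ⊢
    split_ifs at h' ⊢
    · exact h _ h'
    · exact hb _ _ _ (fun s'' h'' => loopWp_mono hb h h'') h'

theorem wp_mono {w : ℕ} {c : Cmd} {Q Q' : Cfg → Prop} {s : Cfg} (hs : wp w c Q s)
    (h : ∀ s', Q s' → Q' s') : wp w c Q' s := by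
  induction c generalizing Q Q' s with
  | seq c e hc he => exact hc hs fun s' h' => he h' h
  | ifEq a b c e hc he | ifLt a b c e hc he =>
    unfold wp at hs ⊢
    split_ifs at hs ⊢
    · exact hc hs h
    · exact he hs fun s' h' => h _ h'
  | whileNe a b c hc =>
    obtain ⟨N, hN⟩ := hs
    exact ⟨N, loopWp_mono (body := wp w c) (fun _ _ _ h' hs' => hc hs' h') h hN⟩
  | const | add | mul => exact ⟨hs.1, h _ hs.2⟩
  | _ => exact h _ hs

/-- Rule for loops: the invariant `I k` holds after `k` rounds, and there are at most `N` rounds. -/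
theorem wp_whileNe {w a b : ℕ} {c : Cmd} {Q : Cfg → Prop} (N : ℕ) (I : ℕ → Cfg → Prop)
    (bound : ∀ k s, I k s → s.reg a ≠ s.reg b → k < N)
    (body : ∀ k s, I k s → s.reg a ≠ s.reg b → wp w c (fun s' => I (k + 1) s'.tick) s.tick)
    (exit : ∀ k s, I k s → s.reg a = s.reg b → Q s.tick) {s : Cfg} (h : I 0 s) :
    wp w (.whileNe a b c) Q s := by
  -- Here `m` bounds the number of remaining rounds. The loop gets one more unit of fuel because the
  -- final, failing test also consumes one.
  have key : ∀ m k s, I k s → N - k ≤ m → loopWp a b (wp w c) Q (m + 1) s := by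
    intro m
    induction m with
    | zero =>
      intro k s hk hm
      unfold loopWp
      split_ifs with hab
      · exact exit k s hk hab
      · have := bound k s hk hab
        omega
    | succ m ih =>
      intro k s hk hm
      rw [loopWp]
      split_ifs with hab
      · exact exit k s hk hab
      · exact wp_mono (body k s hk hab) fun s' h' => ih (k + 1) _ h' (by omega)
  exact ⟨N + 1, key N 0 s h (by omega)⟩

/-! ### Soundness of the compilation -/

/-- The program `P` contains `code` at the address `k`. -/
def CodeAt (P : Program) (k : ℕ) (code : Program) : Prop :=
  ∃ A B, P = A ++ (code ++ B) ∧ A.length = k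

theorem CodeAt.left {P : Program} {k : ℕ} {x y : Program} (h : CodeAt P k (x ++ y)) :
    CodeAt P k x := by
  obtain ⟨A, B, rfl, rfl⟩ := h
  exact ⟨A, y ++ B, by simp, rfl⟩

theorem CodeAt.right {P : Program} {k : ℕ} {x y : Program} (h : CodeAt P k (x ++ y)) :
    CodeAt P (k + x.length) y := by
  obtain ⟨A, B, rfl, rfl⟩ := h
  exact ⟨A ++ x, B, by simp, by simp⟩

theorem CodeAt.head {P : Program} {k : ℕ} {I : Instr} {y : Program} (h : CodeAt P k (I :: y)) :
    P[k]? = some I := by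
  obtain ⟨A, B, rfl, rfl⟩ := h
  simp

theorem CodeAt.tail {P : Program} {k : ℕ} {I : Instr} {y : Program} (h : CodeAt P k (I :: y)) :
    CodeAt P (k + 1) y := by
  obtain ⟨A, B, rfl, rfl⟩ := h
  exact ⟨A ++ [I], B, by simp, by simp⟩

/-- The machine runs from the address `k` in configuration `s` to the address `k'` in `s'`, in
exactly the time shown by the clocks. -/
def Run (w : ℕ) (P : Program) (k : ℕ) (s : Cfg) (k' : ℕ) (s' : Cfg) : Prop :=
  ∃ t, s'.clk = s.clk + t ∧ (step w P)^[t] ⟨k, s.reg, s.mem⟩ = ⟨k', s'.reg, s'.mem⟩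

theorem Run.refl {w : ℕ} {P : Program} {k : ℕ} {s : Cfg} : Run w P k s k s := ⟨0, rfl, rfl⟩

theorem Run.trans {w : ℕ} {P : Program} {k k' k'' : ℕ} {s s' s'' : Cfg}
    (h : Run w P k s k' s') (h' : Run w P k' s' k'' s'') : Run w P k s k'' s'' := by
  obtain ⟨t, h1, h2⟩ := h
  obtain ⟨t', h1', h2'⟩ := h'
  exact ⟨t' + t, by omega, by rw [Function.iterate_add_apply, h2, h2']⟩

theorem Run.single {w : ℕ} {P : Program} {k k' : ℕ} {s s' : Cfg} {I : Instr} (hI : P[k]? = some I)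
    (hc : s'.clk = s.clk + 1) (h : I.exec w ⟨k, s.reg, s.mem⟩ = ⟨k', s'.reg, s'.mem⟩) :
    Run w P k s k' s' :=
  ⟨1, hc, by simpa [step, hI] using h⟩

/-- Induction on the command. The bounds below `2 ^ w` in `wp` make the modular operations exact. In
a conditional the else-branch is laid out first and ends with a jump over the then-branch; this jump
is the extra tick that `wp` charges after the else-branch. -/
theorem wp_sound {w : ℕ} {P : Program} {c : Cmd} {Q : Cfg → Prop} {s : Cfg} {k : ℕ}
    (hs : wp w c Q s) (hP : CodeAt P k (c.compile k)) :
    ∃ s', Q s' ∧ Run w P k s (k + c.size) s' := by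
  induction c generalizing Q s k with
  | skip => exact ⟨s, hs, Run.refl⟩
  | const d v =>
    exact ⟨_, hs.2, .single hP.head rfl (by
      simp [Instr.exec, State.write, Cfg.set, Nat.mod_eq_of_lt hs.1, Cmd.size])⟩
  | add d a b | mul d a b =>
    exact ⟨_, hs.2, .single hP.head rfl (by
      simp [Instr.exec, State.write, Cfg.set, Nat.mod_eq_of_lt hs.1, Cmd.size])⟩
  | move | sub | load | store => exact ⟨_, hs, .single hP.head rfl rfl⟩
  | seq c e hc he =>
    obtain ⟨s₁, h₁, r₁⟩ := hc hs hP.left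
    have hr := hP.right
    rw [Cmd.length_compile] at hr
    obtain ⟨s₂, h₂, r₂⟩ := he h₁ hr
    exact ⟨s₂, h₂, by simpa [Cmd.size, Nat.add_assoc] using r₁.trans r₂⟩
  | ifEq a b c e hc he | ifLt a b c e hc he =>
    unfold wp at hs
    have hr := hP.tail.right
    rw [Cmd.length_compile] at hr
    split_ifs at hs with hab
    · obtain ⟨s', h', r'⟩ := hc (k := k + e.size + 2) hs
        (by convert hr.tail using 1; omega)
      refine ⟨s', h', Run.trans (.single (s' := s.tick) hP.head rfl ?_) (r'.trans ?_)⟩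
      · simp [Instr.exec, hab, Cfg.tick]
      · convert Run.refl using 1; simp only [Cmd.size]; omega
    · obtain ⟨s', h', r'⟩ := he hs hP.tail.left
      refine ⟨s'.tick, h', Run.trans (.single (s' := s.tick) hP.head rfl ?_) (r'.trans
        (.single hr.head rfl ?_))⟩
      · simp [Instr.exec, hab, Cfg.tick]
      · simp [Instr.exec, Cfg.tick, Cmd.size]; omega
  | whileNe a b c hc =>
    obtain ⟨N, hN⟩ := hs
    -- Inner induction on the fuel of the loop; each round is a test, the body, and a jump back to
    -- the test at `k`.
    induction N generalizing s with
    | zero => exact hN.elim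
    | succ N ih =>
      unfold loopWp at hN
      split_ifs at hN with hab
      · exact ⟨_, hN, .single hP.head rfl (by
          simp [Instr.exec, hab, Cfg.tick, Cmd.size]; omega)⟩
      · obtain ⟨s₁, h₁, r₁⟩ := hc hN hP.tail.left
        obtain ⟨s₂, h₂, r₂⟩ := ih h₁
        have hr := hP.tail.right
        rw [Cmd.length_compile] at hr
        refine ⟨s₂, h₂, Run.trans (.single (s' := s.tick) hP.head rfl ?_) (r₁.trans
          (Run.trans (.single hr.head rfl ?_) r₂))⟩
        · simp [Instr.exec, hab, Cfg.tick]
        · simp [Instr.exec, Cfg.tick]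

theorem haltsWithin_of_wp {w : ℕ} {c : Cmd} {s : State} {T out : ℕ} (hpc : s.pc = 0)
    (h : wp w c (fun s' => s'.clk ≤ T ∧ s'.reg 0 = out) ⟨s.reg, s.mem, 0⟩) :
    HaltsWithin w (c.compile 0) s T out := by
  obtain ⟨s', ⟨hT, ho⟩, t, ht, hrun⟩ := wp_sound (P := c.compile 0) (k := 0) h ⟨[], [], by simp⟩
  obtain ⟨pc, reg, mem⟩ := s
  obtain rfl : pc = 0 := hpc
  refine ⟨t, by simp at ht; omega, ?_⟩
  simp only at hrun
  rw [hrun]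
  exact ⟨by simp [Cmd.length_compile], ho⟩

end WordRAM

/-! ## Unit propagation for binary constraints

`K i b j c` says that the value `b` of the variable `i` and the value `c` of the variable `j` exclude
each other. A state `A` gives each variable a code: `0` and `1` are values that have been propagated,
`3` and `4` stand for the values `0` and `1` that have not been propagated yet, and `2` is a variable
without a value. -/

namespace DMC

section Propagation

variable {K : ℕ → ℕ → ℕ → ℕ → Prop} {n : ℕ}

/-- `s` is a solution of the constraints. -/
def IsSolution (K : ℕ → ℕ → ℕ → ℕ → Prop) (n : ℕ) (s : ℕ → ℕ) : Prop :=
  (∀ j < n, s j < 2) ∧ ∀ i < n, ∀ j < n, j ≠ i → ¬ K i (s i) j (s j)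

/-- The assignment `s` extends the state `A`. -/
def Agrees (n : ℕ) (s A : ℕ → ℕ) : Prop :=
  ∀ j < n, ∀ b < 2, (A j = b ∨ A j = b + 3) → s j = b

/-- The value `b` of `p` has been propagated to the variables before `k`, and to `k` for the
constraints on values below `c`. -/
def Propagated (K : ℕ → ℕ → ℕ → ℕ → Prop) (n : ℕ) (A : ℕ → ℕ) (p b k c : ℕ) : Prop :=
  ∀ j < n, j ≠ p → ∀ c' < 2, (j < k ∨ j = k ∧ c' < c) → K p b j c' → A j = 1 - c' ∨ A j = 4 - c'

/-- The number of propagated variables. -/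
def doneCount (n : ℕ) (A : ℕ → ℕ) : ℕ := ((Finset.range n).filter fun j => A j < 2).card

theorem doneCount_le (n : ℕ) (A : ℕ → ℕ) : doneCount n A ≤ n :=
  (Finset.card_filter_le _ _).trans (by simp)

theorem doneCount_congr {A A' : ℕ → ℕ} (h : ∀ j < n, A j < 2 ↔ A' j < 2) :
    doneCount n A = doneCount n A' := by
  unfold doneCount
  congr 1
  exact Finset.filter_congr fun j hj => h j (Finset.mem_range.1 hj)

theorem doneCount_update {A : ℕ → ℕ} {p b : ℕ} (hp : p < n) (hA : 2 ≤ A p) (hb : b < 2) :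
    doneCount n (Function.update A p b) = doneCount n A + 1 := by
  unfold doneCount
  rw [← Finset.card_insert_of_notMem (a := p) (by simp; omega)]
  congr 1
  ext j
  rcases eq_or_ne j p with rfl | hj
  · simp [hp, Nat.le_of_lt_succ hb]
  · simp [hj]

theorem doneCount_update_of_le {A : ℕ → ℕ} {p b : ℕ} (hA : 2 ≤ A p) (hb : 2 ≤ b) :
    doneCount n (Function.update A p b) = doneCount n A := by
  refine doneCount_congr fun j _ => ?_
  rcases eq_or_ne j p with rfl | hj
  · simp; omega
  · simp [hj]

/-! ### Invariants of unit propagation -/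

/-- All values of `V` are propagated. -/
structure Closed (K : ℕ → ℕ → ℕ → ℕ → Prop) (n : ℕ) (V : ℕ → ℕ) : Prop where
  code : ∀ j < n, V j ≤ 2
  closed : ∀ p < n, V p < 2 → Propagated K n V p (V p) n 0

/-- The state `A` gives a value to the variables up to `i`, and it follows from the hypothesis `H`
on the solution. -/
structure Derived (K : ℕ → ℕ → ℕ → ℕ → Prop) (n i : ℕ) (H : (ℕ → ℕ) → Prop)
    (A : ℕ → ℕ) : Prop where
  isSet : ∀ j ≤ i, A j ≠ 2
  code : ∀ j < n, A j ≤ 4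
  closed : ∀ p < n, A p < 2 → Propagated K n A p (A p) n 0
  forced : ∀ s, H s → Agrees n s A

/-- As `Derived`, while the value `b` of `p` is being propagated. -/
structure Expanding (K : ℕ → ℕ → ℕ → ℕ → Prop) (n i : ℕ) (H : (ℕ → ℕ) → Prop)
    (p b k c : ℕ) (A : ℕ → ℕ) : Prop where
  isSet : ∀ j ≤ i, A j ≠ 2
  code : ∀ j < n, A j ≤ 4
  closed : ∀ q < n, q ≠ p → A q < 2 → Propagated K n A q (A q) n 0
  forced : ∀ s, H s → Agrees n s A
  val : A p = b
  row : Propagated K n A p b k c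

variable {V A : ℕ → ℕ} {H : (ℕ → ℕ) → Prop} {i p b k c : ℕ}

theorem Derived.expanding (h : Derived K n i H A) (hp : p < n) (hb : b < 2) (hA : A p = b + 3) :
    Expanding K n i H p b 0 0 (Function.update A p b) where
  isSet j hj := by
    rcases eq_or_ne j p with rfl | hjp
    · simp; omega
    · simpa [hjp] using h.isSet j hj
  code j hj := by
    rcases eq_or_ne j p with rfl | hjp
    · simp; omega
    · simpa [hjp] using h.code j hj
  closed q hq hqp hA' j hj hjq c' hc' hlt hK := by
    simp only [Function.update_of_ne hqp] at hA' hK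
    have := h.closed q hq hA' j hj hjq c' hc' hlt hK
    rcases eq_or_ne j p with rfl | hjp
    · simp; omega
    · simpa [hjp] using this
  forced s hs j hj b' hb' hA' := by
    rcases eq_or_ne j p with rfl | hjp
    · simp only [Function.update_self] at hA'
      exact h.forced s hs j hj b' hb' (by omega)
    · simp only [Function.update_of_ne hjp] at hA'
      exact h.forced s hs j hj b' hb' hA'
  val := by simp
  row j _ _ c' _ hlt := by omega

theorem Expanding.advance (h : Expanding K n i H p b k c A)
    (hk : k ≠ p → K p b k c → A k = 1 - c ∨ A k = 4 - c) : Expanding K n i H p b k (c + 1) A where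
  __ := h
  row j hj hjp c' hc' hlt hK := by
    by_cases hlt' : j < k ∨ j = k ∧ c' < c
    · exact h.row j hj hjp c' hc' hlt' hK
    · obtain ⟨rfl, rfl⟩ : j = k ∧ c' = c := by omega
      exact hk hjp hK

/-- Every solution under `H` has the value `b` at `p`, so it cannot have `c` at `k` and must have `1
- c` there. The code `4 - c = (1 - c) + 3` records this value as pending. -/
theorem Expanding.force (h : Expanding K n i H p b k c A) (hH : ∀ s, H s → IsSolution K n s)
    (hp : p < n) (hk : k < n) (hkp : k ≠ p) (hb : b < 2) (hc : c < 2) (hA : A k = 2)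
    (hK : K p b k c) : Expanding K n i H p b k (c + 1) (Function.update A k (4 - c)) := by
  have hup : ∀ {j c'}, c' < 2 → A j = 1 - c' ∨ A j = 4 - c' →
      Function.update A k (4 - c) j = 1 - c' ∨ Function.update A k (4 - c) j = 4 - c' := by
    intro j c' hc' hj
    rcases eq_or_ne j k with rfl | hjk
    · omega
    · simpa [hjk] using hj
  have h' : Expanding K n i H p b k c (Function.update A k (4 - c)) :=
    { isSet := fun j hj => by
        rcases eq_or_ne j k with rfl | hjk
        -- The variables up to `i` are set, so an unset `k` lies beyond them.
        · exact absurd hA (h.isSet j hj)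
        · simpa [hjk] using h.isSet j hj
      code := fun j hj => by
        rcases eq_or_ne j k with rfl | hjk
        · simp
        · simpa [hjk] using h.code j hj
      closed := fun q hq hqp hA' j hj hjq c' hc' hlt hK' => by
        rcases eq_or_ne q k with rfl | hqk
        · simp only [Function.update_self] at hA'
          omega
        · simp only [Function.update_of_ne hqk] at hA' hK'
          exact hup hc' (h.closed q hq hqp hA' j hj hjq c' hc' hlt hK')
      forced := fun s hs j hj b' hb' hA' => by
        rcases eq_or_ne j k with rfl | hjk
        · have hsp : s p = b := h.forced s hs p hp b hb (.inl h.val)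
          have h1 := (hH s hs).2 p hp j hj hkp
          have h2 := (hH s hs).1 j hj
          have h3 : s j ≠ c := by
            rintro rfl
            exact h1 (hsp ▸ hK)
          simp only [Function.update_self] at hA'
          omega
        · simp only [Function.update_of_ne hjk] at hA'
          exact h.forced s hs j hj b' hb' hA'
      val := by simpa [hkp.symm] using h.val
      row := fun j hj hjp c' hc' hlt hK' => hup hc' (h.row j hj hjp c' hc' hlt hK') }
  exact h'.advance fun _ _ => .inr (by simp)

/-- Both values that occur in the violated constraint are forced under `H`. -/
theorem Expanding.contradiction (h : Expanding K n i H p b k c A)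
    (hH : ∀ s, H s → IsSolution K n s) (hp : p < n) (hk : k < n) (hkp : k ≠ p) (hb : b < 2)
    (hc : c < 2) (hA : A k = c ∨ A k = c + 3) (hK : K p b k c) : ∀ s, ¬ H s := by
  intro s hs
  refine (hH s hs).2 p hp k hk hkp ?_
  rwa [h.forced s hs p hp b hb (.inl h.val), h.forced s hs k hk c hc hA]

theorem Expanding.nextRow (h : Expanding K n i H p b k c A) (hc : k = p ∨ c = 2) :
    Expanding K n i H p b (k + 1) 0 A where
  __ := h
  row j hj hjp c' hc' hlt hK := h.row j hj hjp c' hc' (by omega) hK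

theorem Expanding.derived (h : Expanding K n i H p b n 0 A) : Derived K n i H A where
  __ := h
  closed q hq hA := by
    rcases eq_or_ne q p with rfl | hqp
    · rw [h.val]
      exact h.row
    · exact h.closed q hq hqp hA

/-- Without the pending codes `3` and `4`, every value present has been propagated. -/
theorem Derived.toClosed (h : Derived K n i H A) (hA : ∀ j < n, A j < 3) : Closed K n A where
  code j hj := by
    have := hA j hj
    omega
  closed := h.closed

theorem Propagated.congr {A' : ℕ → ℕ} (h : Propagated K n A p b k c) (hA : ∀ j < n, A' j = A j) :
    Propagated K n A' p b k c := by
  intro j hj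
  rw [hA j hj]
  exact h j hj

theorem Closed.congr (h : Closed K n A) (hA : ∀ j < n, V j = A j) : Closed K n V where
  code j hj := hA j hj ▸ h.code j hj
  closed p hp hV := by
    rw [hA p hp] at hV ⊢
    exact (h.closed p hp hV).congr hA

theorem Derived.congr {A' : ℕ → ℕ} (h : Derived K n i H A) (hi : i < n)
    (hA : ∀ j < n, A' j = A j) : Derived K n i H A' where
  isSet j hj := hA j (by omega) ▸ h.isSet j hj
  code j hj := hA j hj ▸ h.code j hj
  closed p hp hV := by
    rw [hA p hp] at hV ⊢
    exact (h.closed p hp hV).congr hA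
  forced s hs j hj := by
    rw [hA j hj]
    exact h.forced s hs j hj

/-! ### Guesses and limited backtracking -/

/-- The hypothesis that a solution extends `V` and has the value `b` at `i`. -/
def Guess (K : ℕ → ℕ → ℕ → ℕ → Prop) (n : ℕ) (V : ℕ → ℕ) (i b : ℕ) (s : ℕ → ℕ) : Prop :=
  IsSolution K n s ∧ Agrees n s V ∧ s i = b

/-- The guess is entered as a pending value. Earlier propagations survive because none of them could
have concerned `i`: it would then already have a value. -/
theorem Closed.derived (h : Closed K n V) (hi : V i = 2) (hV : ∀ j < i, V j < 2) (hb : b < 2) :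
    Derived K n i (Guess K n V i b) (Function.update V i (b + 3)) where
  isSet j hj := by
    rcases eq_or_ne j i with rfl | hji
    · simp
    · have := hV j (by omega)
      simp [hji]; omega
  code j hj := by
    rcases eq_or_ne j i with rfl | hji
    · simp; omega
    · have := h.code j hj
      simp [hji]; omega
  closed q hq hA j hj hjq c' hc' hlt hK := by
    rcases eq_or_ne q i with rfl | hqi
    · simp at hA
    · simp only [Function.update_of_ne hqi] at hA hK
      have := h.closed q hq hA j hj hjq c' hc' hlt hK
      rcases eq_or_ne j i with rfl | hji
      · omega
      · simpa [hji] using this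
  forced s hs j hj b' hb' hA := by
    rcases eq_or_ne j i with rfl | hji
    · simp only [Function.update_self] at hA
      have := hs.2.2
      omega
    · simp only [Function.update_of_ne hji] at hA
      exact hs.2.1 j hj b' hb' hA

/-- The values of a closed state can be kept. -/
theorem Closed.exists_agrees (h : Closed K n V) (hK : ∀ i b j c, K i b j c → K j c i b)
    {s : ℕ → ℕ} (hs : IsSolution K n s) : ∃ s, IsSolution K n s ∧ Agrees n s V := by
  -- If an assigned value excludes `c` at `j`, closedness has already put the opposite value there;
  -- a pending code is ruled out by `h.code`. So no constraint links an assigned variable to a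
  -- compatible-looking free one.
  have key : ∀ i < n, ∀ j < n, j ≠ i → V i < 2 → ∀ c < 2, K i (V i) j c → V j = 1 - c := by
    intro i hi j hj hji hV c hc hc'
    have := h.closed i hi hV j hj hji c hc (.inl hj) hc'
    have := h.code j hj
    omega
  refine ⟨fun j => if V j < 2 then V j else s j, ⟨fun j hj => ?_, fun i hi j hj hji hc => ?_⟩,
    fun j hj b hb hA => ?_⟩
  · dsimp only
    split_ifs with hV
    · exact hV
    · exact hs.1 j hj
  · dsimp only at hc
    split_ifs at hc with h1 h2 h2
    · have := key i hi j hj hji h1 _ h2 hc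
      omega
    · have := key i hi j hj hji h1 _ (hs.1 j hj) hc
      omega
    · have := key j hj i hi hji.symm h2 _ (hs.1 i hi) (hK _ _ _ _ hc)
      omega
    · exact hs.2 i hi j hj hji hc
  · have := h.code j hj
    have hV : V j = b := by omega
    simp [hV, hb]

/-- Any solution can be changed to one that extends `V`, and that one satisfies one of the two
guesses. -/
theorem Closed.not_exists_isSolution (h : Closed K n V) (hK : ∀ i b j c, K i b j c → K j c i b)
    (hi : i < n) (h0 : ∀ s, ¬ Guess K n V i 0 s) (h1 : ∀ s, ¬ Guess K n V i 1 s) :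
    ¬ ∃ s, IsSolution K n s := by
  rintro ⟨s, hs⟩
  obtain ⟨s, hs, ha⟩ := h.exists_agrees hK hs
  have := hs.1 i hi
  have h01 : s i = 0 ∨ s i = 1 := by omega
  rcases h01 with h' | h'
  · exact h0 s ⟨hs, ha, h'⟩
  · exact h1 s ⟨hs, ha, h'⟩

theorem Closed.isSolution (h : Closed K n V) (hV : ∀ j < n, V j < 2) : IsSolution K n V := by
  refine ⟨hV, fun i hi j hj hji hc => ?_⟩
  have := h.closed i hi (hV i hi) j hj hji _ (hV j hj) (.inl hj) hc
  have := hV j hj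
  omega

end Propagation

/-! ### The constraints of a matrix -/

/-- The entry with the code `e`, where a missing entry is replaced by `b`. -/
def fill (b e : ℕ) : ℕ := if e = 2 then b else e

/-- The Hamming distance of the first `t` entries of the rows `i` and `j`, filled with `b` and `c`,
of the matrix with `l` columns that is stored in `M`. -/
def prefixDist (l : ℕ) (M : ℕ → ℕ) (i b j c t : ℕ) : ℕ :=
  ∑ x ∈ Finset.range t, if fill b (M (i * l + x)) = fill c (M (j * l + x)) then 0 else 1

/-- The rows `i` and `j`, filled with `b` and `c`, violate a bound on the distance. -/
def Conflict (l α β : ℕ) (M : ℕ → ℕ) (i b j c : ℕ) : Prop :=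
  prefixDist l M i b j c l < α ∨ β < prefixDist l M i b j c l

theorem prefixDist_comm (l : ℕ) (M : ℕ → ℕ) (i b j c t : ℕ) :
    prefixDist l M i b j c t = prefixDist l M j c i b t := by
  simp only [prefixDist, eq_comm]

theorem prefixDist_le (l : ℕ) (M : ℕ → ℕ) (i b j c t : ℕ) : prefixDist l M i b j c t ≤ t := by
  refine (Finset.sum_le_card_nsmul _ _ 1 fun x _ => ?_).trans (by simp)
  split_ifs <;> simp

theorem Conflict.symm {l α β : ℕ} {M : ℕ → ℕ} (i b j c : ℕ) (h : Conflict l α β M i b j c) :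
    Conflict l α β M j c i b := by
  unfold Conflict at h ⊢
  rwa [prefixDist_comm l M j c i b]

/-- The memory in the initial state. -/
abbrev inputMem {n l : ℕ} (S : IncompleteMatrix n l) : ℕ → ℕ := (initialState S 0 0).mem

theorem inputMem_apply {n l : ℕ} (S : IncompleteMatrix n l) (i : Fin n) (x : Fin l) :
    inputMem S (i * l + x) = entryCode (S i x) := by
  have hlt : (i : ℕ) * l + x < n * l := by
    calc (i : ℕ) * l + x < i * l + l := by omega
      _ = (i + 1) * l := by ring
      _ ≤ n * l := Nat.mul_le_mul_right _ i.2
  have hl : 0 < l := x.pos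
  have h1 : Fin.divNat (⟨(i : ℕ) * l + x, hlt⟩ : Fin (n * l)) = i := by
    ext
    simp [Fin.divNat, Nat.mul_add_div hl, mul_comm _ l]
  have h2 : Fin.modNat (⟨(i : ℕ) * l + x, hlt⟩ : Fin (n * l)) = x := by
    ext
    simp [Fin.modNat, mul_comm _ l, Nat.mod_eq_of_lt x.2]
  simp only [inputMem, initialState, hlt, dif_pos, h1, h2]

theorem prefixDist_eq_hammingDist {n l : ℕ} (S : IncompleteMatrix n l)
    (T : Matrix (Fin n) (Fin l) Bool) (i j : Fin n) (b c : ℕ)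
    (hi : ∀ x, fill b (entryCode (S i x)) = (T i x).toNat)
    (hj : ∀ x, fill c (entryCode (S j x)) = (T j x).toNat) :
    prefixDist l (inputMem S) i b j c l = hammingDist (T i) (T j) := by
  unfold prefixDist
  rw [Finset.sum_range, hammingDist, Finset.card_filter]
  refine Finset.sum_congr rfl fun x _ => ?_
  rw [inputMem_apply, inputMem_apply, hi, hj]
  cases T i x <;> cases T j x <;> simp

theorem le_gamma_and_delta_le_iff {n l : ℕ} (T : Matrix (Fin n) (Fin l) Bool) (α β : ℕ) :
    ((α : ℕ∞) ≤ gamma T ∧ delta T ≤ (β : ℕ∞)) ↔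
      ∀ i j, i ≠ j → α ≤ hammingDist (T i) (T j) ∧ hammingDist (T i) (T j) ≤ β := by
  simp only [gamma, delta, le_iInf_iff, iSup_le_iff, Nat.cast_le, ← forall_and]

/-- The value of the variable `i` is the bit placed in the missing entry of row `i`. In a complete
row it has no effect. -/
theorem isYes_iff {n l : ℕ} (S : IncompleteMatrix n l) (α β : ℕ) (hS : MissingPerRowLE S 1) :
    IsYes S α β ↔ ∃ s, IsSolution (Conflict l α β (inputMem S)) n s := by
  unfold IsYes
  simp only [le_gamma_and_delta_le_iff]
  constructor
  · rintro ⟨T, hT, hd⟩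
    -- Since the missing entry of a row is unique, a single bit reproduces the row of `T`; for a
    -- complete row `0` serves.
    have hex : ∀ i : Fin n, ∃ b < 2, ∀ x, fill b (entryCode (S i x)) = (T i x).toNat := by
      intro i
      have hone := Finset.card_le_one.1 (hS i)
      simp only [Finset.mem_filter, Finset.mem_univ, true_and] at hone
      have hknown : ∀ b x, S i x ≠ none → fill b (entryCode (S i x)) = (T i x).toNat := by
        intro b x hx
        rw [(hT i x).resolve_left hx]
        cases T i x <;> simp [fill, entryCode]
      by_cases hm : ∃ x, S i x = none
      · obtain ⟨x, hx⟩ := hm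
        refine ⟨(T i x).toNat, Bool.toNat_lt _, fun y => ?_⟩
        by_cases hy : S i y = none
        · rw [hone y hy x hx, hx]
          simp [fill, entryCode]
        · exact hknown _ y hy
      · exact ⟨0, by omega, fun y => hknown _ y fun hy => hm ⟨y, hy⟩⟩
    choose f hf2 hf using hex
    refine ⟨fun i => if h : i < n then f ⟨i, h⟩ else 0, fun j hj => by simp [hj, hf2],
      fun i hi j hj hji => ?_⟩
    have := hd ⟨i, hi⟩ ⟨j, hj⟩ (by simpa using hji.symm)
    have he := prefixDist_eq_hammingDist S T ⟨i, hi⟩ ⟨j, hj⟩ _ _ (hf ⟨i, hi⟩) (hf ⟨j, hj⟩)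
    simp only [hi, hj, dif_pos, Conflict]
    simp only at he
    omega
  · rintro ⟨s, hs2, hs⟩
    let T : Matrix (Fin n) (Fin l) Bool := fun i x => (S i x).getD (s i == 1)
    have hT : ∀ (i : Fin n) x, fill (s i) (entryCode (S i x)) = (T i x).toNat := by
      intro i x
      have h2 := hs2 i i.2
      have h01 : s i = 0 ∨ s i = 1 := by omega
      simp only [T]
      rcases S i x with _ | _ | _ <;> rcases h01 with h | h <;> simp [fill, entryCode, h]
    refine ⟨T, fun i x => ?_, fun i j hij => ?_⟩
    · simp only [T]
      cases S i x <;> simp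
    · have := hs i i.2 j j.2 (by simpa [Fin.ext_iff] using hij.symm)
      rw [Conflict, prefixDist_eq_hammingDist S T i j _ _ (hT i) (hT j)] at this
      omega

end DMC

/-! ## The program -/

namespace DMC

open WordRAM

@[simp] theorem _root_.WordRAM.Cfg.reg_tick (s : Cfg) : s.tick.reg = s.reg := rfl
@[simp] theorem _root_.WordRAM.Cfg.mem_tick (s : Cfg) : s.tick.mem = s.mem := rfl
@[simp] theorem _root_.WordRAM.Cfg.clk_tick (s : Cfg) : s.tick.clk = s.clk + 1 := rfl
@[simp] theorem _root_.WordRAM.Cfg.mem_set (s : Cfg) (d v : ℕ) : (s.set d v).mem = s.mem := rfl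
@[simp] theorem _root_.WordRAM.Cfg.clk_set (s : Cfg) (d v : ℕ) :
    (s.set d v).clk = s.clk + 1 := rfl
@[simp] theorem _root_.WordRAM.Cfg.reg_set_self (s : Cfg) (d v : ℕ) : (s.set d v).reg d = v := by
  simp [Cfg.set]
@[simp] theorem _root_.WordRAM.Cfg.reg_set_ne (s : Cfg) {d x : ℕ} (v : ℕ) (h : x ≠ d) :
    (s.set d v).reg x = s.reg x := by
  simp [Cfg.set, h]

@[simp] theorem _root_.WordRAM.Cfg.mem_put (s : Cfg) (a v : ℕ) :
    (s.put a v).mem = Function.update s.mem a v := rfl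
@[simp] theorem _root_.WordRAM.Cfg.reg_put (s : Cfg) (a v : ℕ) : (s.put a v).reg = s.reg := rfl
@[simp] theorem _root_.WordRAM.Cfg.clk_put (s : Cfg) (a v : ℕ) :
    (s.put a v).clk = s.clk + 1 := rfl

/-! ### Memory layout and the distance of two rows -/

/-- The registers and the memory that stay fixed: the input, the constants and the addresses of
three arrays of `n` words behind the input. -/
structure Env (n l α β : ℕ) (M : ℕ → ℕ) (s : Cfg) : Prop where
  r0 : s.reg 0 = n
  r1 : s.reg 1 = l
  r2 : s.reg 2 = α
  r3 : s.reg 3 = β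
  r4 : s.reg 4 = 0
  r5 : s.reg 5 = 1
  r6 : s.reg 6 = 2
  r7 : s.reg 7 = n * l
  r8 : s.reg 8 = n * l + n
  r9 : s.reg 9 = n * l + n + n
  r10 : s.reg 10 = 3
  r11 : s.reg 11 = 4
  input : ∀ x < n * l, s.mem x = M x

variable {w n l α β : ℕ} {M : ℕ → ℕ} {s s' : Cfg} {Q : Cfg → Prop}

theorem Env.frame (h : Env n l α β M s) (hr : ∀ x < 12, s'.reg x = s.reg x)
    (hm : ∀ x < n * l, s'.mem x = s.mem x) : Env n l α β M s' where
  r0 := (hr _ (by omega)).trans h.r0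
  r1 := (hr _ (by omega)).trans h.r1
  r2 := (hr _ (by omega)).trans h.r2
  r3 := (hr _ (by omega)).trans h.r3
  r4 := (hr _ (by omega)).trans h.r4
  r5 := (hr _ (by omega)).trans h.r5
  r6 := (hr _ (by omega)).trans h.r6
  r7 := (hr _ (by omega)).trans h.r7
  r8 := (hr _ (by omega)).trans h.r8
  r9 := (hr _ (by omega)).trans h.r9
  r10 := (hr _ (by omega)).trans h.r10
  r11 := (hr _ (by omega)).trans h.r11
  input x hx := (hm x hx).trans (h.input x hx)

/-- All addresses and constants fit into a word. -/
def Fits (w n l : ℕ) : Prop := n * l + 3 * n + l + 4 < 2 ^ w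

theorem index_lt {i x : ℕ} (hi : i < n) (hx : x < l) : i * l + x < n * l :=
  calc i * l + x < i * l + l := by omega
    _ = (i + 1) * l := by ring
    _ ≤ n * l := Nat.mul_le_mul_right _ hi

/-- The body of the loop that computes a distance. -/
@[irreducible] def distBody : Cmd :=
  .load 35 31 ;; .ifEq 35 6 (.move 35 23) .skip ;;
  .load 36 32 ;; .ifEq 36 6 (.move 36 24) .skip ;;
  .ifEq 35 36 .skip (.add 33 33 5) ;;
  .add 31 31 5 ;; .add 32 32 5 ;; .add 34 34 5

/-- Adds the distance of two rows to `R[33]`. -/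
@[irreducible] def distLoop : Cmd := .whileNe 34 1 distBody

/-- `R[30] := 1` if the rows `R[20]` and `R[21]`, filled with `R[23]` and `R[24]`, are in conflict,
and `R[30] := 0` otherwise. -/
@[irreducible] def conflict : Cmd :=
  .mul 31 20 1 ;; .mul 32 21 1 ;; .const 33 0 ;; .const 34 0 ;; distLoop ;; .const 30 0 ;;
  .ifLt 33 2 (.const 30 1) .skip ;; .ifLt 3 33 (.const 30 1) .skip

/-- Like the later specifications, this one takes the postcondition as a continuation `hQ`, which
receives the unchanged registers and memory, the new values, and a bound on the clock.
Specifications can thus be chained without intermediate assertions. -/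
theorem wp_distBody (hw : Fits w n l) (E : Env n l α β M s) {p b j c t : ℕ} (hp : p < n)
    (hj : j < n) (ht : t < l) (h23 : s.reg 23 = b) (h24 : s.reg 24 = c)
    (h31 : s.reg 31 = p * l + t) (h32 : s.reg 32 = j * l + t)
    (h33 : s.reg 33 = prefixDist l M p b j c t) (h34 : s.reg 34 = t)
    (hQ : ∀ s', (∀ x < 30, s'.reg x = s.reg x) → s'.mem = s.mem → s'.reg 31 = p * l + (t + 1) →
      s'.reg 32 = j * l + (t + 1) → s'.reg 33 = prefixDist l M p b j c (t + 1) →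
      s'.reg 34 = t + 1 → s'.clk ≤ s.clk + 14 → Q s') :
    wp w distBody Q s := by
  have hpl := index_lt hp ht
  have hjl := index_lt hj ht
  have hd := prefixDist_le l M p b j c t
  unfold Fits at hw
  have hs : prefixDist l M p b j c (t + 1) = prefixDist l M p b j c t +
      if fill b (M (p * l + t)) = fill c (M (j * l + t)) then 0 else 1 := by
    simp [prefixDist, Finset.sum_range_succ]
  simp only [fill] at hs
  have e5 := E.r5
  have e6 := E.r6
  have m1 := E.input _ hpl
  have m2 := E.input _ hjl
  simp (disch := omega) only [distBody, wp, Cfg.reg_set_self, Cfg.reg_set_ne, Cfg.mem_set,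
    Cfg.reg_tick, Cfg.mem_tick, h23, h24, h31, h32, h33, h34, e5, e6, m1, m2]
  -- The branches of the program are those of `fill` and of the comparison in the new summand.
  split_ifs at hs ⊢ <;> (repeat refine ⟨by omega, ?_⟩) <;>
    refine hQ _ (fun x hx => ?_) ?_ ?_ ?_ ?_ ?_ ?_ <;>
    simp (disch := omega) only [Cfg.reg_set_self, Cfg.reg_set_ne, Cfg.mem_set, Cfg.clk_set,
      Cfg.clk_tick, Cfg.reg_tick, Cfg.mem_tick] <;> omega

theorem wp_distLoop (hw : Fits w n l) (E : Env n l α β M s) {p b j c : ℕ} (hp : p < n)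
    (hj : j < n) (h23 : s.reg 23 = b) (h24 : s.reg 24 = c)
    (h31 : s.reg 31 = p * l) (h32 : s.reg 32 = j * l) (h33 : s.reg 33 = 0) (h34 : s.reg 34 = 0)
    (hQ : ∀ s', (∀ x < 30, s'.reg x = s.reg x) → s'.mem = s.mem →
      s'.reg 33 = prefixDist l M p b j c l → s'.clk ≤ s.clk + 16 * l + 1 → Q s') :
    wp w distLoop Q s := by
  unfold distLoop
  refine wp_whileNe l (fun t s' => t ≤ l ∧ (∀ x < 30, s'.reg x = s.reg x) ∧ s'.mem = s.mem ∧
    s'.reg 31 = p * l + t ∧ s'.reg 32 = j * l + t ∧ s'.reg 33 = prefixDist l M p b j c t ∧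
    s'.reg 34 = t ∧ s'.clk ≤ s.clk + 16 * t) ?_ ?_ ?_ ?_
  · rintro t s' ⟨ht, hr, -, -, -, -, h, -⟩ hne
    rw [h, hr 1 (by omega), E.r1] at hne
    omega
  · rintro t s' ⟨ht, hr, hm, h31, h32, h33, h34, hc⟩ hne
    rw [h34, hr 1 (by omega), E.r1] at hne
    refine wp_distBody hw (E.frame (fun x hx => hr x (by omega)) (fun x _ => congrFun hm x)) hp hj
      (t := t) (by omega) ((hr _ (by omega)).trans h23) ((hr _ (by omega)).trans h24) h31 h32 h33
      h34 fun s'' hr' hm' h31 h32 h33 h34 hc' => ?_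
    exact ⟨by omega, fun x hx => (hr' x hx).trans (hr x hx), hm'.trans hm, h31, h32, h33, h34,
      by simp only [Cfg.clk_tick] at hc' ⊢; omega⟩
  · rintro t s' ⟨ht, hr, hm, h31, h32, h33, h34, hc⟩ he
    rw [h34, hr 1 (by omega), E.r1] at he
    subst he
    exact hQ _ hr hm h33 (by simp only [Cfg.clk_tick]; omega)
  · exact ⟨by omega, fun _ _ => rfl, rfl, h31, h32, by simp [prefixDist, h33], h34, le_rfl⟩

theorem wp_conflict (hw : Fits w n l) (E : Env n l α β M s) {p b j c : ℕ} (hp : p < n)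
    (hj : j < n) (h20 : s.reg 20 = p) (h21 : s.reg 21 = j) (h23 : s.reg 23 = b)
    (h24 : s.reg 24 = c)
    (hQ : ∀ s', (∀ x < 30, s'.reg x = s.reg x) → s'.mem = s.mem →
      (s'.reg 30 = 1 ↔ Conflict l α β M p b j c) → s'.clk ≤ s.clk + 16 * l + 12 → Q s') :
    wp w conflict Q s := by
  have hpl := Nat.mul_le_mul_right l hp.le
  have hjl := Nat.mul_le_mul_right l hj.le
  unfold Fits at hw
  simp (disch := omega) only [conflict, wp, Cfg.reg_set_ne, h20, h21, E.r1]
  repeat refine ⟨by omega, ?_⟩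
  refine wp_distLoop hw (E.frame (fun x hx => ?_) (fun x _ => ?_)) hp hj (b := b) (c := c)
    ?_ ?_ ?_ ?_ ?_ ?_ fun s' hr hm h33 hc => ?_
  any_goals simp (disch := omega) only [Cfg.reg_set_self, Cfg.reg_set_ne, Cfg.mem_set]
  · exact h23
  · exact h24
  simp only [Cfg.clk_set, Cfg.mem_set] at hc hm
  have hr' : ∀ x < 30, s'.reg x = s.reg x := fun x hx => by
    rw [hr x hx]
    simp (disch := omega) only [Cfg.reg_set_ne]
  refine ⟨by omega, ?_⟩
  have e2 : s'.reg 2 = α := (hr' 2 (by omega)).trans E.r2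
  have e3 : s'.reg 3 = β := (hr' 3 (by omega)).trans E.r3
  unfold Conflict at hQ
  simp (disch := omega) only [Cfg.reg_set_ne, Cfg.reg_tick, h33, e2, e3]
  split_ifs <;> (repeat refine ⟨by omega, ?_⟩) <;>
    refine hQ _ (fun x hx => ?_) hm ?_ ?_ <;>
    simp (disch := omega) only [Cfg.reg_set_self, Cfg.reg_set_ne, Cfg.clk_set,
      Cfg.clk_tick, Cfg.reg_tick, hr', true_iff] <;> omega

/-! ### Propagation in one array -/

/-- The array at the address `a`. -/
def arr (a : ℕ) (m : ℕ → ℕ) : ℕ → ℕ := fun j => m (a + j)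

theorem arr_update (a : ℕ) (m : ℕ → ℕ) (j v : ℕ) :
    arr a (Function.update m (a + j) v) = Function.update (arr a m) j v := by
  ext x
  simp [arr, Function.update_apply]

/-- Takes the value `R[24]` away from the variable `R[21]`, which is stored at `R[25]`, if it is in
conflict with the value `R[23]` of `R[20]`; sets `R[19] := 1` if this is contradictory. -/
@[irreducible] def force : Cmd :=
  conflict ;; .ifEq 30 5 (.load 22 25 ;; .ifEq 22 6 (.sub 22 11 24 ;; .store 25 22)
    (.ifEq 22 24 (.const 19 1) (.add 26 24 10 ;; .ifEq 22 26 (.const 19 1) .skip))) .skip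

/-- The body of `expandLoop`. -/
@[irreducible] def expandBody : Cmd :=
  .ifEq 21 20 .skip (.add 25 18 21 ;; .const 24 0 ;; force ;; .const 24 1 ;; force) ;; .add 21 21 5

/-- Propagates the value `R[23]` of `R[20]` to the other variables. -/
@[irreducible] def expandLoop : Cmd := .whileNe 21 0 expandBody

/-- Propagates the variable `R[20]` in the array at `R[18]`. -/
@[irreducible] def expand : Cmd :=
  .add 22 18 20 ;; .load 23 22 ;; .sub 23 23 10 ;; .store 22 23 ;; .const 21 0 ;; expandLoop

/-- The body of `scanLoop`. -/
@[irreducible] def scanBody : Cmd :=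
  .add 22 18 21 ;; .load 22 22 ;; .ifLt 22 10 .skip (.move 20 21) ;; .add 21 21 5

/-- Looks for a variable that has to be propagated in the array at `R[18]`. -/
@[irreducible] def scanLoop : Cmd := .whileNe 21 0 scanBody

/-- If `R[19] = 0`, propagates one variable in the array at `R[18]`; if none is left, sets
`R[14] := 1` and `R[15] := R[18]`. -/
@[irreducible] def sideStep : Cmd :=
  .ifEq 19 4 (.move 20 0 ;; .const 21 0 ;; scanLoop ;;
    .ifEq 20 0 (.const 14 1 ;; .move 15 18) expand) .skip

section Side

variable {i a m p b j c : ℕ} {H : (ℕ → ℕ) → Prop}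

/-- The state of an array while a value is being propagated; `R[19]` tells whether the array is
contradictory. -/
def ExpandInv (K : ℕ → ℕ → ℕ → ℕ → Prop) (n i : ℕ) (H : (ℕ → ℕ) → Prop) (a m p b k c : ℕ)
    (s : Cfg) : Prop :=
  (s.reg 19 = 0 ∧ Expanding K n i H p b k c (arr a s.mem) ∧ doneCount n (arr a s.mem) = m) ∨
    (s.reg 19 = 1 ∧ ∀ s, ¬ H s)

/-- The state of an array between two steps; `f` tells whether the array is contradictory. -/
def SideInv (K : ℕ → ℕ → ℕ → ℕ → Prop) (n i : ℕ) (H : (ℕ → ℕ) → Prop) (a m f : ℕ)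
    (M : ℕ → ℕ) : Prop :=
  (f = 0 ∧ Derived K n i H (arr a M) ∧ doneCount n (arr a M) = m) ∨ (f = 1 ∧ ∀ s, ¬ H s)

/-- The cases follow the code of `j`: unset, already `c` (propagated or pending), or already the
opposite value. After a contradiction the code keeps running, but the flag stays `1` and the
invariant no longer speaks about the array. -/
theorem wp_force (hw : Fits w n l) (E : Env n l α β M s)
    (hH : ∀ s, H s → IsSolution (Conflict l α β M) n s)
    (hp : p < n) (hb : b < 2) (hj : j < n) (hc : c < 2) (hjp : j ≠ p)
    (h20 : s.reg 20 = p) (h21 : s.reg 21 = j) (h23 : s.reg 23 = b)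
    (h24 : s.reg 24 = c) (h25 : s.reg 25 = a + j)
    (hI : ExpandInv (Conflict l α β M) n i H a m p b j c s)
    (hQ : ∀ s', (∀ x < 26, x ≠ 19 → x ≠ 22 → s'.reg x = s.reg x) →
      (∀ x, x < a ∨ a + n ≤ x → s'.mem x = s.mem x) →
      ExpandInv (Conflict l α β M) n i H a m p b j (c + 1) s' →
      s'.clk ≤ s.clk + 16 * l + 21 → Q s') :
    wp w force Q s := by
  unfold force
  simp only [wp]
  refine wp_conflict hw E hp hj h20 h21 h23 h24 fun s₁ hr hm hK hc₁ => ?_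
  unfold Fits at hw
  have e5 : s₁.reg 5 = 1 := (hr 5 (by omega)).trans E.r5
  have e6 : s₁.reg 6 = 2 := (hr 6 (by omega)).trans E.r6
  have e10 : s₁.reg 10 = 3 := (hr 10 (by omega)).trans E.r10
  have e11 : s₁.reg 11 = 4 := (hr 11 (by omega)).trans E.r11
  have e24 : s₁.reg 24 = c := (hr 24 (by omega)).trans h24
  have e25 : s₁.reg 25 = a + j := (hr 25 (by omega)).trans h25
  have e19 := hr 19 (by omega)
  have hv : arr a s.mem j = s.mem (a + j) := rfl
  simp (disch := omega) only [Cfg.reg_set_self, Cfg.reg_set_ne, Cfg.reg_tick, Cfg.mem_tick, e5,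
    e6, e10, e11, e24, e25, hm]
  split_ifs with h1 h2 h3 h4 <;> (repeat refine ⟨by omega, ?_⟩) <;>
    refine hQ _ (fun x hx h19 h22 => ?_) (fun x hx => ?_) ?_ ?_ <;>
    simp (disch := omega) only [Cfg.reg_set_self, Cfg.reg_set_ne, Cfg.mem_set, Cfg.clk_set,
      Cfg.clk_tick, Cfg.reg_tick, Cfg.mem_tick, Cfg.mem_put, Cfg.reg_put, Cfg.clk_put, hr, hm,
      Function.update_of_ne, ExpandInv, true_and, false_and, false_or, one_ne_zero] <;>
    rw [hK] at h1 <;> try omega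
  · rcases hI with ⟨hf, hX, hd⟩ | ⟨hf, hX⟩
    · refine .inl ⟨hf, ?_, ?_⟩
      · rw [arr_update]
        exact hX.force hH hp hj hjp hb hc (hv.trans h2) h1
      · rw [arr_update, doneCount_update_of_le (by omega) (by omega), hd]
    · exact .inr ⟨hf, hX⟩
  · rcases hI with ⟨hf, hX, hd⟩ | ⟨hf, hX⟩
    · exact hX.contradiction hH hp hj hjp hb hc (by omega) h1
    · exact hX
  · rcases hI with ⟨hf, hX, hd⟩ | ⟨hf, hX⟩
    · exact hX.contradiction hH hp hj hjp hb hc (by omega) h1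
    · exact hX
  -- The remaining codes up to `4` are `1 - c` and `4 - c`, so the constraint is already respected.
  · rcases hI with ⟨hf, hX, hd⟩ | ⟨hf, hX⟩
    · have := hX.code j hj
      exact .inl ⟨hf, hX.advance fun _ _ => by omega, hd⟩
    · exact .inr ⟨hf, hX⟩
  · rcases hI with ⟨hf, hX, hd⟩ | ⟨hf, hX⟩
    · exact .inl ⟨hf, hX.advance fun _ hK => absurd hK h1, hd⟩
    · exact .inr ⟨hf, hX⟩

theorem ExpandInv.nextRow {K : ℕ → ℕ → ℕ → ℕ → Prop} {k : ℕ}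
    (h : ExpandInv K n i H a m p b k c s) (hc : k = p ∨ c = 2) (hr : s'.reg 19 = s.reg 19)
    (hm : s'.mem = s.mem) : ExpandInv K n i H a m p b (k + 1) 0 s' := by
  unfold ExpandInv
  rw [hr, hm]
  exact h.imp (fun h => ⟨h.1, h.2.1.nextRow hc, h.2.2⟩) id

theorem wp_expandBody (hw : Fits w n l) (E : Env n l α β M s)
    (hH : ∀ s, H s → IsSolution (Conflict l α β M) n s)
    (ha : n * l ≤ a) (ha' : a + n ≤ n * l + 3 * n)
    (hp : p < n) (hb : b < 2) (hj : j < n) (h18 : s.reg 18 = a)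
    (h20 : s.reg 20 = p) (h21 : s.reg 21 = j) (h23 : s.reg 23 = b)
    (hI : ExpandInv (Conflict l α β M) n i H a m p b j 0 s)
    (hQ : ∀ s', (∀ x < 24, x ≠ 19 → x ≠ 21 → x ≠ 22 → s'.reg x = s.reg x) →
      (∀ x, x < a ∨ a + n ≤ x → s'.mem x = s.mem x) → s'.reg 21 = j + 1 →
      ExpandInv (Conflict l α β M) n i H a m p b (j + 1) 0 s' →
      s'.clk ≤ s.clk + 32 * l + 54 → Q s') :
    wp w expandBody Q s := by
  have hw' := hw
  unfold Fits at hw'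
  unfold expandBody
  simp only [wp, Cfg.reg_tick, E.r5, h18, h20, h21]
  split_ifs with hjp
  · refine ⟨by omega, hQ _ (fun x hx h19 h21 h22 => ?_) (fun x hx => rfl) ?_
      (hI.nextRow (.inl hjp) ?_ rfl) ?_⟩ <;>
    simp (disch := omega) only [Cfg.reg_set_self, Cfg.reg_set_ne, Cfg.reg_tick, Cfg.clk_set,
      Cfg.clk_tick]
    omega
  · refine ⟨by omega, by omega, ?_⟩
    refine wp_force hw (E.frame (fun x hx => ?_) (fun x _ => rfl)) hH hp hb hj (c := 0)
      (by omega) hjp ?_ ?_ ?_ ?_ ?_ (a := a) (m := m) (i := i) ?_ fun s₁ hr₁ hm₁ hI₁ hc₁ => ?_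
    rotate_right
    · refine ⟨by omega, ?_⟩
      have E₁ : Env n l α β M s₁ := E.frame (fun x hx => by
        rw [hr₁ x (by omega) (by omega) (by omega)]
        simp (disch := omega) only [Cfg.reg_set_ne, Cfg.reg_tick]) fun x hx => hm₁ x (by omega)
      have f : ∀ x, x ∈ [20, 21, 23, 25] → s₁.reg x = if x = 25 then a + j else s.reg x := by
        intro x hx
        simp only [List.mem_cons, List.not_mem_nil, or_false] at hx
        rw [hr₁ x (by omega) (by omega) (by omega)]
        rcases hx with rfl | rfl | rfl | rfl <;> simp
      refine wp_force hw (E₁.frame (fun x hx => ?_) (fun x _ => rfl)) hH hp hb hj (c := 1)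
        (by omega) hjp ?_ ?_ ?_ ?_ ?_ (a := a) (m := m) (i := i) ?_ fun s₂ hr₂ hm₂ hI₂ hc₂ => ?_
      rotate_right
      · have e21 : s₂.reg 21 = j := by
          rw [hr₂ 21 (by omega) (by omega) (by omega)]
          simp [f, h21]
        have e5 : s₂.reg 5 = 1 := by
          rw [hr₂ 5 (by omega) (by omega) (by omega)]
          simp [E₁.r5]
        simp only [e21, e5]
        refine ⟨by omega, hQ _ (fun x hx h19 h21 h22 => ?_) (fun x hx => ?_) ?_
          (hI₂.nextRow (.inr rfl) ?_ rfl) ?_⟩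
        · simp (disch := omega) only [Cfg.reg_set_ne, Cfg.reg_tick]
          rw [hr₂ x (by omega) (by omega) (by omega)]
          simp (disch := omega) only [Cfg.reg_set_ne]
          rw [hr₁ x (by omega) (by omega) (by omega)]
          simp (disch := omega) only [Cfg.reg_set_ne, Cfg.reg_tick]
        · exact (hm₂ x hx).trans (hm₁ x hx)
        · simp
        · simp
        · simp only [Cfg.clk_set, Cfg.clk_tick] at hc₁ hc₂ ⊢
          omega
      · simp (disch := omega) only [Cfg.reg_set_ne]
      · simp [f, h20]
      · simp [f, h21]
      · simp [f, h23]
      · simp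
      · simp [f]
      · exact hI₁
    · simp (disch := omega) only [Cfg.reg_set_ne, Cfg.reg_tick]
    · simp [h20]
    · simp [h21]
    · simp [h23]
    · simp
    · simp
    · exact hI

theorem wp_expandLoop (hw : Fits w n l) (E : Env n l α β M s)
    (hH : ∀ s, H s → IsSolution (Conflict l α β M) n s)
    (ha : n * l ≤ a) (ha' : a + n ≤ n * l + 3 * n)
    (hp : p < n) (hb : b < 2) (h18 : s.reg 18 = a)
    (h20 : s.reg 20 = p) (h21 : s.reg 21 = 0) (h23 : s.reg 23 = b)
    (hI : ExpandInv (Conflict l α β M) n i H a m p b 0 0 s)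
    (hQ : ∀ s', (∀ x < 19, s'.reg x = s.reg x) →
      (∀ x, x < a ∨ a + n ≤ x → s'.mem x = s.mem x) →
      ExpandInv (Conflict l α β M) n i H a m p b n 0 s' →
      s'.clk ≤ s.clk + n * (32 * l + 56) + 1 → Q s') :
    wp w expandLoop Q s := by
  unfold expandLoop
  refine wp_whileNe n (fun t s' => t ≤ n ∧
    (∀ x < 24, x ≠ 19 → x ≠ 21 → x ≠ 22 → s'.reg x = s.reg x) ∧
    (∀ x, x < a ∨ a + n ≤ x → s'.mem x = s.mem x) ∧ s'.reg 21 = t ∧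
    ExpandInv (Conflict l α β M) n i H a m p b t 0 s' ∧
    s'.clk ≤ s.clk + t * (32 * l + 56)) ?_ ?_ ?_ ?_
  · rintro t s' ⟨ht, hr, -, h, -⟩ hne
    rw [h, hr 0 (by omega) (by omega) (by omega) (by omega), E.r0] at hne
    omega
  · rintro t s' ⟨ht, hr, hm, h, hI, hc⟩ hne
    rw [h, hr 0 (by omega) (by omega) (by omega) (by omega), E.r0] at hne
    have hr' : ∀ x < 24, x ≠ 19 → x ≠ 21 → x ≠ 22 → s'.tick.reg x = s.reg x := hr
    refine wp_expandBody hw (E.frame (fun x hx => hr x (by omega) (by omega) (by omega) (by omega))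
      fun x hx => hm x (by omega)) hH ha ha' hp hb (show t < n by omega) (i := i) (m := m)
      ((hr' _ (by omega) (by omega) (by omega) (by omega)).trans h18)
      ((hr' _ (by omega) (by omega) (by omega) (by omega)).trans h20) h
      ((hr' _ (by omega) (by omega) (by omega) (by omega)).trans h23) hI
      fun s₁ hr₁ hm₁ h₁ hI₁ hc₁ => ?_
    refine ⟨by omega, fun x hx h1 h2 h3 => (hr₁ x hx h1 h2 h3).trans (hr x hx h1 h2 h3),
      fun x hx => (hm₁ x hx).trans (hm x hx), h₁, hI₁, ?_⟩
    simp only [Cfg.clk_tick, Nat.add_mul, Nat.one_mul] at hc₁ ⊢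
    omega
  · rintro t s' ⟨ht, hr, hm, h, hI, hc⟩ he
    rw [h, hr 0 (by omega) (by omega) (by omega) (by omega), E.r0] at he
    subst he
    exact hQ _ (fun x hx => hr x (by omega) (by omega) (by omega) (by omega)) hm hI
      (by simp only [Cfg.clk_tick]; omega)
  · exact ⟨by omega, fun _ _ _ _ _ => rfl, fun _ _ => rfl, h21, hI, by omega⟩

theorem wp_expand (hw : Fits w n l) (E : Env n l α β M s)
    (hH : ∀ s, H s → IsSolution (Conflict l α β M) n s)
    (ha : n * l ≤ a) (ha' : a + n ≤ n * l + 3 * n)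
    (hp : p < n) (h18 : s.reg 18 = a) (h19 : s.reg 19 = 0) (h20 : s.reg 20 = p)
    (hpend : 3 ≤ arr a s.mem p) (hD : Derived (Conflict l α β M) n i H (arr a s.mem))
    (hQ : ∀ s', (∀ x < 19, s'.reg x = s.reg x) →
      (∀ x, x < a ∨ a + n ≤ x → s'.mem x = s.mem x) →
      SideInv (Conflict l α β M) n i H a (doneCount n (arr a s.mem) + 1) (s'.reg 19) s'.mem →
      s'.clk ≤ s.clk + n * (32 * l + 56) + 6 → Q s') :
    wp w expand Q s := by
  have hw' := hw
  unfold Fits at hw'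
  have hv : s.mem (a + p) = arr a s.mem p := rfl
  have hcode := hD.code p hp
  unfold expand
  simp (disch := omega) only [wp, Cfg.reg_set_self, Cfg.reg_set_ne, Cfg.mem_set, h18, h20, E.r10,
    hv]
  refine ⟨by omega, by omega, ?_⟩
  refine wp_expandLoop hw (E.frame (fun x hx => ?_) (fun x hx => ?_)) hH ha ha' hp
    -- Subtracting `3` turns the pending code into the propagated one, and this raises the count by
    -- one.
    (b := arr a s.mem p - 3) (m := doneCount n (arr a s.mem) + 1) (i := i) (by omega)
    ?_ ?_ ?_ ?_ ?_ fun s₁ hr₁ hm₁ hI₁ hc₁ => ?_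
  · simp (disch := omega) only [Cfg.reg_set_ne, Cfg.reg_put]
  · simp (disch := omega) only [Cfg.mem_set, Cfg.mem_put, Function.update_of_ne]
  · simp [h18]
  · simp [h20]
  · simp
  · simp
  · refine .inl ⟨by simp [h19], ?_, ?_⟩
    · simp only [Cfg.mem_set, Cfg.mem_put, arr_update]
      exact hD.expanding hp (by omega) (by omega)
    · simp only [Cfg.mem_set, Cfg.mem_put, arr_update]
      exact doneCount_update hp (by omega) (by omega)
  · refine hQ _ (fun x hx => ?_) (fun x hx => ?_) ?_ ?_
    · rw [hr₁ x hx]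
      simp (disch := omega) only [Cfg.reg_set_ne, Cfg.reg_put]
    · rw [hm₁ x hx]
      simp (disch := omega) only [Cfg.mem_set, Cfg.mem_put, Function.update_of_ne]
    · exact hI₁.imp (fun h => ⟨h.1, h.2.1.derived, h.2.2⟩) id
    · simp only [Cfg.clk_set, Cfg.clk_put] at hc₁
      omega

/-- The initial value `n` of `R[20]` serves as a sentinel for an unsuccessful search. A linear scan
is affordable, as the propagation that follows a hit visits all variables anyway. -/
theorem wp_scanLoop (hw : Fits w n l) (E : Env n l α β M s)
    (ha' : a + n ≤ n * l + 3 * n) (h18 : s.reg 18 = a) (h20 : s.reg 20 = n) (h21 : s.reg 21 = 0)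
    (hQ : ∀ s', (∀ x < 20, s'.reg x = s.reg x) → s'.mem = s.mem →
      (s'.reg 20 = n ∧ (∀ j < n, arr a s.mem j < 3) ∨
        s'.reg 20 < n ∧ 3 ≤ arr a s.mem (s'.reg 20)) → s'.clk ≤ s.clk + 8 * n + 1 → Q s') :
    wp w scanLoop Q s := by
  unfold Fits at hw
  unfold scanLoop
  refine wp_whileNe n (fun t s' => t ≤ n ∧ (∀ x < 20, s'.reg x = s.reg x) ∧ s'.mem = s.mem ∧
    s'.reg 21 = t ∧ (s'.reg 20 = n ∧ (∀ j < t, arr a s.mem j < 3) ∨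
        s'.reg 20 < n ∧ 3 ≤ arr a s.mem (s'.reg 20)) ∧ s'.clk ≤ s.clk + 8 * t) ?_ ?_ ?_ ?_
  · rintro t s' ⟨ht, hr, -, h, -⟩ hne
    rw [h, hr 0 (by omega), E.r0] at hne
    omega
  · rintro t s' ⟨ht, hr, hm, h, h3, hc⟩ hne
    rw [h, hr 0 (by omega), E.r0] at hne
    have e18 := (hr 18 (by omega)).trans h18
    have e5 := (hr 5 (by omega)).trans E.r5
    have e10 := (hr 10 (by omega)).trans E.r10
    have hv : s.mem (a + t) = arr a s.mem t := rfl
    unfold scanBody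
    simp (disch := omega) only [wp, Cfg.reg_set_self, Cfg.reg_set_ne, Cfg.mem_set, Cfg.reg_tick,
      Cfg.mem_tick, Cfg.clk_tick, Cfg.clk_set, h, hm, e18, e5, e10, hv]
    split_ifs with hlt <;> refine ⟨by omega, by omega, by omega, fun x hx => by
      simp (disch := omega) only [Cfg.reg_set_ne, Cfg.reg_tick, hr], trivial, trivial, ?_,
      by omega⟩
    · refine h3.imp_left fun h3 => ⟨h3.1, fun j hj => ?_⟩
      rcases Nat.lt_succ_iff_lt_or_eq.1 hj with hj | rfl
      · exact h3.2 j hj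
      · exact hlt
    · exact .inr ⟨by omega, by omega⟩
  · rintro t s' ⟨ht, hr, hm, h, h3, hc⟩ he
    rw [h, hr 0 (by omega), E.r0] at he
    subst he
    exact hQ _ hr hm h3 (by simp only [Cfg.clk_tick]; omega)
  · exact ⟨by omega, fun _ _ => rfl, rfl, h21, .inl ⟨h20, by omega⟩, le_rfl⟩

/-- The outcome of a step: either there was nothing left to propagate, or a variable has been
propagated or a contradiction found. -/
def SidePost (K : ℕ → ℕ → ℕ → ℕ → Prop) (n i : ℕ) (H : (ℕ → ℕ) → Prop) (a m : ℕ)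
    (s s' : Cfg) : Prop :=
  (s'.reg 14 = 1 ∧ s'.reg 15 = a ∧ s'.reg 19 = 0 ∧ Derived K n i H (arr a s'.mem) ∧
    (∀ j < n, arr a s'.mem j < 3) ∧ doneCount n (arr a s'.mem) = m) ∨
  (s'.reg 14 = s.reg 14 ∧ s'.reg 15 = s.reg 15 ∧ SideInv K n i H a (m + 1) (s'.reg 19) s'.mem)

theorem wp_sideStep (hw : Fits w n l) (E : Env n l α β M s)
    (hH : ∀ s, H s → IsSolution (Conflict l α β M) n s)
    (ha : n * l ≤ a) (ha' : a + n ≤ n * l + 3 * n) (h18 : s.reg 18 = a)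
    (hI : SideInv (Conflict l α β M) n i H a m (s.reg 19) s.mem)
    (hQ : ∀ s', (∀ x < 18, x ≠ 14 → x ≠ 15 → s'.reg x = s.reg x) →
      (∀ x, x < a ∨ a + n ≤ x → s'.mem x = s.mem x) →
      SidePost (Conflict l α β M) n i H a m s s' →
      s'.clk ≤ s.clk + n * (32 * l + 64) + 16 → Q s') :
    wp w sideStep Q s := by
  have hw' := hw
  unfold Fits at hw'
  have hn : n * (32 * l + 64) = n * (32 * l + 56) + 8 * n := by ring
  unfold sideStep
  simp only [wp, E.r4]
  rcases hI with ⟨hf, hD, hd⟩ | ⟨hf, hX⟩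
  · rw [if_pos hf]
    refine ⟨by omega, wp_scanLoop hw (E.frame (fun x hx => ?_) fun x _ => rfl) ha' (a := a)
      ?_ ?_ ?_ fun s₁ hr₁ hm₁ hp hc₁ => ?_⟩
    · simp (disch := omega) only [Cfg.reg_set_ne, Cfg.reg_tick]
    · simp [h18]
    · simp [E.r0]
    · simp
    · have hr₁' : ∀ x < 20, s₁.reg x = s.reg x := fun x hx => by
        rw [hr₁ x hx]
        simp (disch := omega) only [Cfg.reg_set_ne, Cfg.reg_tick]
      simp only [Cfg.mem_set, Cfg.mem_tick, Cfg.clk_set, Cfg.clk_tick] at hm₁ hp hc₁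
      have E₁ : Env n l α β M s₁ := E.frame (fun x hx => hr₁' x (by omega))
        fun x _ => congrFun hm₁ x
      simp (disch := omega) only [Cfg.reg_set_ne, Cfg.reg_tick, E₁.r0, hr₁' 18, h18]
      rcases hp with ⟨hp, hlt⟩ | ⟨hp, hge⟩
      · rw [if_pos hp]
        refine ⟨by omega, hQ _ (fun x hx h14 h15 => ?_) (fun x hx => ?_) (.inl ?_) ?_⟩ <;>
          simp (disch := omega) only [Cfg.reg_set_ne, Cfg.reg_set_self, Cfg.reg_tick, Cfg.mem_set,
            Cfg.mem_tick, Cfg.clk_set, Cfg.clk_tick, hm₁, hr₁']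
        · exact ⟨trivial, trivial, hf, hD, hlt, hd⟩
        · omega
      · rw [if_neg (by omega)]
        refine wp_expand hw (E₁.frame (fun _ _ => rfl) fun _ _ => rfl) hH ha ha' hp (i := i)
          ((hr₁' 18 (by omega)).trans h18) ((hr₁' 19 (by omega)).trans hf) rfl
          (by simpa [hm₁] using hge) (by simpa [hm₁] using hD) fun s₂ hr₂ hm₂ hI₂ hc₂ => ?_
        simp only [Cfg.mem_tick, Cfg.clk_tick, Cfg.reg_tick, hm₁] at hr₂ hm₂ hI₂ hc₂
        have hr₂' : ∀ x < 19, s₂.reg x = s.reg x := fun x hx =>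
          (hr₂ x hx).trans (hr₁' x (by omega))
        refine hQ _ (fun x hx h14 h15 => hr₂' x (by omega)) hm₂
          (.inr ⟨hr₂' 14 (by omega), hr₂' 15 (by omega), ?_⟩) ?_
        · rw [← hd]
          exact hI₂
        · simp only [Cfg.clk_tick]
          omega
  · rw [if_neg (by omega)]
    exact hQ _ (fun _ _ _ _ => rfl) (fun _ _ => rfl) (.inr ⟨rfl, rfl, .inr ⟨hf, hX⟩⟩)
      (by simp only [Cfg.clk_tick]; omega)

end Side

/-! ### Propagation in lock-step -/

/-- The body of `copyLoop`. -/
@[irreducible] def copyBody : Cmd :=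
  .add 22 24 21 ;; .load 22 22 ;; .add 23 25 21 ;; .store 23 22 ;; .add 21 21 5

/-- Copies the entries of the array at `R[24]` from the index `R[21]` on. -/
@[irreducible] def copyLoop : Cmd := .whileNe 21 0 copyBody

/-- Copies the array at `R[24]` to `R[25]`. -/
@[irreducible] def copyArr : Cmd := .const 21 0 ;; copyLoop

/-- One step of the propagation in both arrays. -/
@[irreducible] def lockBody : Cmd :=
  .move 18 8 ;; .move 19 16 ;; sideStep ;; .move 16 19 ;;
  .move 18 9 ;; .move 19 17 ;; sideStep ;; .move 17 19 ;;
  .ifEq 16 5 (.ifEq 17 5 (.const 14 1 ;; .const 13 0) .skip) .skip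

/-- Propagates in both arrays until one of them is closed or both are contradictory. -/
@[irreducible] def lockLoop : Cmd := .whileNe 14 5 lockBody

/-- Finds a value for the variable `R[12]`, or sets `R[13] := 0` if there is no solution. -/
@[irreducible] def assign : Cmd :=
  .move 24 7 ;; .move 25 8 ;; copyArr ;; .move 25 9 ;; copyArr ;;
  .add 27 8 12 ;; .store 27 10 ;; .add 27 9 12 ;; .store 27 11 ;;
  .const 14 0 ;; .const 16 0 ;; .const 17 0 ;; lockLoop ;;
  .ifEq 13 5 (.move 24 15 ;; .move 25 7 ;; copyArr) .skip

/-- The body of `mainLoop`. -/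
@[irreducible] def mainBody : Cmd :=
  .ifEq 13 5 (.add 27 7 12 ;; .load 27 27 ;; .ifEq 27 6 assign .skip) .skip ;; .add 12 12 5

/-- Finds values for the variables from `R[12]` on. -/
@[irreducible] def mainLoop : Cmd := .whileNe 12 0 mainBody

/-- The body of `initLoop`. -/
@[irreducible] def initBody : Cmd := .add 22 7 21 ;; .store 22 6 ;; .add 21 21 5

/-- Makes all variables unassigned. -/
@[irreducible] def initLoop : Cmd := .whileNe 21 0 initBody

/-- The program that decides Diameter Matrix Completion with one missing entry per row. -/
@[irreducible] def decideDMC : Cmd :=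
  .const 4 0 ;; .const 5 1 ;; .const 6 2 ;; .const 10 3 ;; .const 11 4 ;;
  .mul 7 0 1 ;; .add 8 7 0 ;; .add 9 8 0 ;; .const 13 1 ;;
  .ifEq 1 4 (.ifEq 2 4 .skip (.ifLt 5 0 (.const 13 0) .skip))
    (.const 21 0 ;; initLoop ;; .const 12 0 ;; mainLoop) ;;
  .move 0 13

theorem wp_copyArr (hw : Fits w n l) (E : Env n l α β M s) {a b : ℕ} (h24 : s.reg 24 = a)
    (h25 : s.reg 25 = b) (ha : a + n ≤ n * l + 3 * n) (hb : b + n ≤ n * l + 3 * n)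
    (hab : a + n ≤ b ∨ b + n ≤ a)
    (hb' : n * l ≤ b)
    (hQ : ∀ s', (∀ x, x < 21 ∨ 23 < x → s'.reg x = s.reg x) →
      (∀ x, x < b ∨ b + n ≤ x → s'.mem x = s.mem x) →
      (∀ j < n, arr b s'.mem j = arr a s.mem j) → s'.clk ≤ s.clk + 7 * n + 2 → Q s') :
    wp w copyArr Q s := by
  unfold Fits at hw
  unfold copyArr copyLoop
  rw [wp, wp]
  refine ⟨by omega, wp_whileNe n (fun t s' => t ≤ n ∧
    (∀ x, x < 21 ∨ 23 < x → s'.reg x = s.reg x) ∧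
    (∀ x, x < b ∨ b + t ≤ x → s'.mem x = s.mem x) ∧ s'.reg 21 = t ∧
    (∀ j < t, arr b s'.mem j = arr a s.mem j) ∧ s'.clk ≤ s.clk + 1 + 7 * t) ?_ ?_ ?_ ?_⟩
  · rintro t s' ⟨ht, hr, -, h, -⟩ hne
    rw [h, hr 0 (by omega), E.r0] at hne
    omega
  · rintro t s' ⟨ht, hr, hm, h, hc, hk⟩ hne
    rw [h, hr 0 (by omega), E.r0] at hne
    have e24 := (hr 24 (by omega)).trans h24
    have e25 := (hr 25 (by omega)).trans h25
    have e5 := (hr 5 (by omega)).trans E.r5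
    have hv := hm (a + t) (by omega)
    unfold copyBody
    simp (disch := omega) only [wp, Cfg.reg_set_self, Cfg.reg_set_ne, Cfg.mem_set, Cfg.reg_tick,
      Cfg.mem_tick, Cfg.clk_tick, Cfg.clk_set, Cfg.reg_put, Cfg.mem_put, Cfg.clk_put, h, e24, e25,
      e5]
    refine ⟨by omega, by omega, by omega, by omega, fun x hx => ?_, fun x hx => ?_, trivial,
      fun j hj => ?_, by omega⟩
    · simp (disch := omega) only [Cfg.reg_set_ne, Cfg.reg_tick, Cfg.reg_put, hr]
    · simp (disch := omega) only [Function.update_of_ne, hm]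
    · rw [arr_update, hv]
      rcases eq_or_ne j t with rfl | hjt
      · simp [arr]
      · rw [Function.update_of_ne hjt, hc j (by omega)]
  · rintro t s' ⟨ht, hr, hm, h, hc, hk⟩ he
    rw [h, hr 0 (by omega), E.r0] at he
    subst he
    exact hQ _ hr hm hc (by simp only [Cfg.clk_tick]; omega)
  · exact ⟨by omega, fun x hx => by simp (disch := omega) only [Cfg.reg_set_ne], fun _ _ => rfl,
      by simp, by simp, by simp⟩

section Lock

variable {i : ℕ} {V : ℕ → ℕ} {K : ℕ → ℕ → ℕ → ℕ → Prop}

theorem SideInv.congr {H : (ℕ → ℕ) → Prop} {a m f f' : ℕ} {m₁ m₂ : ℕ → ℕ}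
    (h : SideInv K n i H a m f m₁) (hi : i < n) (hf : f' = f)
    (hm : ∀ x, a ≤ x → x < a + n → m₂ x = m₁ x) : SideInv K n i H a m f' m₂ := by
  have hA : ∀ j < n, arr a m₂ j = arr a m₁ j := fun j hj => hm _ (by omega) (by omega)
  subst hf
  exact h.imp (fun h => ⟨h.1, h.2.1.congr hi hA,
    (doneCount_congr fun j hj => by rw [hA j hj]).trans h.2.2⟩) id

/-- The propagation goes on in at least one of the two arrays. -/
def Running (K : ℕ → ℕ → ℕ → ℕ → Prop) (n l i : ℕ) (V : ℕ → ℕ) (m : ℕ) (s : Cfg) : Prop :=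
  s.reg 14 = 0 ∧ s.reg 13 = 1 ∧
    SideInv K n i (Guess K n V i 0) (n * l + n) m (s.reg 16) s.mem ∧
    SideInv K n i (Guess K n V i 1) (n * l + n + n) m (s.reg 17) s.mem ∧
    ¬ (s.reg 16 = 1 ∧ s.reg 17 = 1)

/-- One of the two arrays is closed. -/
def Won (K : ℕ → ℕ → ℕ → ℕ → Prop) (n l i m : ℕ) (s : Cfg) : Prop :=
  s.reg 14 = 1 ∧ s.reg 13 = 1 ∧ (s.reg 15 = n * l + n ∨ s.reg 15 = n * l + n + n) ∧
    Closed K n (arr (s.reg 15) s.mem) ∧ (∀ j ≤ i, arr (s.reg 15) s.mem j ≠ 2) ∧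
    doneCount n (arr (s.reg 15) s.mem) + 1 = m

/-- Both arrays are contradictory. -/
def Lost (K : ℕ → ℕ → ℕ → ℕ → Prop) (n m : ℕ) (s : Cfg) : Prop :=
  s.reg 14 = 1 ∧ s.reg 13 = 0 ∧ (¬ ∃ s, IsSolution K n s) ∧ m ≤ n + 1

/-- The invariant of `lockLoop`. -/
def LockInv (K : ℕ → ℕ → ℕ → ℕ → Prop) (n l i : ℕ) (V : ℕ → ℕ) (m : ℕ) (s : Cfg) : Prop :=
  Running K n l i V m s ∨ Won K n l i m s ∨ Lost K n m s

/-- At least one array is not contradictory, and `m` counts its propagated variables. This bounds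
the number of rounds. -/
theorem Running.le {m : ℕ} (h : Running K n l i V m s) : m ≤ n := by
  obtain ⟨-, -, h1, h2, h⟩ := h
  rcases h1 with ⟨-, -, rfl⟩ | ⟨h1, -⟩
  · exact doneCount_le _ _
  rcases h2 with ⟨-, -, rfl⟩ | ⟨h2, -⟩
  · exact doneCount_le _ _
  · exact absurd ⟨h1, h2⟩ h

theorem wp_lockBody (hw : Fits w n l) (E : Env n l α β M s) (hi : i < n)
    (hV : Closed (Conflict l α β M) n V) {m : ℕ}
    (hI : Running (Conflict l α β M) n l i V m s)
    (hQ : ∀ s', (∀ x < 13, s'.reg x = s.reg x) → (∀ x < n * l + n, s'.mem x = s.mem x) →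
      LockInv (Conflict l α β M) n l i V (m + 1) s' →
      s'.clk ≤ s.clk + 2 * (n * (32 * l + 64)) + 48 → Q s') :
    wp w lockBody Q s := by
  have hw' := hw
  unfold Fits at hw'
  have hmn := hI.le
  obtain ⟨h14, h13, hI0, hI1, -⟩ := hI
  unfold lockBody
  simp (disch := omega) only [wp, Cfg.reg_set_ne, E.r8]
  refine wp_sideStep hw (E.frame (fun x hx => ?_) fun x _ => rfl) (fun _ h => h.1)
    (a := n * l + n) (i := i) (m := m) (H := Guess (Conflict l α β M) n V i 0) (by omega) (by omega)
    ?_ ?_ fun s₁ hr₁ hm₁ hp₁ hc₁ => ?_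
  · simp (disch := omega) only [Cfg.reg_set_ne]
  · simp
  · simpa using hI0
  have hr₁' : ∀ x < 18, x ≠ 14 → x ≠ 15 → s₁.reg x = s.reg x := fun x hx h1 h2 => by
    rw [hr₁ x hx h1 h2]
    simp (disch := omega) only [Cfg.reg_set_ne]
  simp only [Cfg.mem_set, Cfg.clk_set] at hm₁ hc₁
  have E₁ : Env n l α β M s₁ := E.frame (fun x hx => hr₁' x (by omega) (by omega) (by omega))
    fun x hx => hm₁ x (by omega)
  have e17 : s₁.reg 17 = s.reg 17 := hr₁' 17 (by omega) (by omega) (by omega)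
  simp (disch := omega) only [E₁.r9]
  refine wp_sideStep hw (E₁.frame (fun x hx => ?_) fun x _ => rfl) (fun _ h => h.1)
    (a := n * l + n + n) (i := i) (m := m) (H := Guess (Conflict l α β M) n V i 1) (by omega)
    (by omega) ?_ ?_ fun s₂ hr₂ hm₂ hp₂ hc₂ => ?_
  · simp (disch := omega) only [Cfg.reg_set_ne]
  · simp
  · exact hI1.congr hi (by simpa using e17) fun x hx _ => hm₁ x (by omega)
  simp only [Cfg.mem_set, Cfg.clk_set] at hm₂ hc₂
  have hr₂' : ∀ x < 18, x ≠ 14 → x ≠ 15 → x ≠ 16 → s₂.reg x = s.reg x := fun x hx h1 h2 h3 => by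
    rw [hr₂ x hx h1 h2]
    simp (disch := omega) only [Cfg.reg_set_ne]
    exact hr₁' x hx h1 h2
  have e16 : s₂.reg 16 = s₁.reg 19 := by
    rw [hr₂ 16 (by omega) (by omega) (by omega)]
    simp
  have hm : ∀ x < n * l + n, s₂.mem x = s.mem x := fun x hx =>
    (hm₂ x (by omega)).trans (hm₁ x (by omega))
  have hA : ∀ j < n, arr (n * l + n) s₂.mem j = arr (n * l + n) s₁.mem j :=
    fun j hj => hm₂ _ (by omega)
  have e13 := (hr₂' 13 (by omega) (by omega) (by omega) (by omega)).trans h13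
  have e5 := (hr₂' 5 (by omega) (by omega) (by omega) (by omega)).trans E.r5
  unfold SidePost at hp₁ hp₂
  simp (disch := omega) only [Cfg.reg_set_ne] at hp₁ hp₂
  simp (disch := omega) only [Cfg.reg_set_self, Cfg.reg_set_ne, Cfg.reg_tick, e16, e5]
  have fin : ∀ s', (∀ x < 18, x ≠ 13 → x ≠ 14 → x ≠ 17 → s'.reg x = s₂.reg x) →
      s'.mem = s₂.mem → LockInv (Conflict l α β M) n l i V (m + 1) s' →
      s'.clk ≤ s₂.clk + 5 → Q s' := fun s' hr' hm' hI' hc' =>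
    hQ s' (fun x hx => (hr' x (by omega) (by omega) (by omega) (by omega)).trans
      (hr₂' x (by omega) (by omega) (by omega) (by omega))) (fun x hx => by rw [hm', hm x hx])
      hI' (by omega)
  by_cases hboth : s₁.reg 19 = 1 ∧ s₂.reg 19 = 1
  · rw [if_pos hboth.1, if_pos hboth.2]
    refine ⟨by omega, by omega, fin _ (fun x hx h1 h2 h3 => ?_) rfl (.inr (.inr ⟨?_, ?_, ?_, ?_⟩)) ?_⟩
    · simp (disch := omega) only [Cfg.reg_set_ne, Cfg.reg_tick]
    · simp
    · simp
    -- A flag `1` is compatible only with a refuted guess; the other outcomes leave the flag at `0`.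
    · rcases hp₁ with ⟨-, -, h, -⟩ | ⟨-, -, ⟨h, -⟩ | ⟨-, hX₁⟩⟩
      · omega
      · omega
      rcases hp₂ with ⟨-, -, h, -⟩ | ⟨-, -, ⟨h, -⟩ | ⟨-, hX₂⟩⟩
      · omega
      · omega
      exact hV.not_exists_isSolution Conflict.symm hi hX₁ hX₂
    · omega
    · simp only [Cfg.clk_set, Cfg.clk_tick]
      omega
  · have main : ∀ s', (∀ x < 18, x ≠ 17 → s'.reg x = s₂.reg x) → s'.reg 17 = s₂.reg 19 →
        s'.mem = s₂.mem → s'.clk ≤ s₂.clk + 5 → Q s' := by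
      intro s' hr' h17 hm' hc'
      refine fin s' (fun x hx _ _ h => hr' x hx h) hm' ?_ hc'
      have f13 := (hr' 13 (by omega) (by omega)).trans e13
      have f14 := hr' 14 (by omega) (by omega)
      have f15 := hr' 15 (by omega) (by omega)
      have f16 := (hr' 16 (by omega) (by omega)).trans e16
      -- The second array is examined first: if both are closed in the same round, it overwrites the
      -- address that the first one left in `R[15]`.
      rcases hp₂ with ⟨g14, g15, g19, hD, hlt, hd⟩ | ⟨g14, g15, hX₂⟩
      · refine .inr (.inl ⟨by omega, f13, .inr (by omega), ?_, ?_, ?_⟩) <;>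
          rw [f15, g15, hm']
        · exact hD.toClosed hlt
        · exact hD.isSet
        · omega
      · rcases hp₁ with ⟨k14, k15, k19, hD, hlt, hd⟩ | ⟨k14, k15, hX₁⟩
        · have hD' := hD.congr hi hA
          refine .inr (.inl ⟨by omega, f13, .inl (by omega), ?_, ?_, ?_⟩) <;>
            rw [f15, g15, k15, hm']
          · exact hD'.toClosed fun j hj => hA j hj ▸ hlt j hj
          · exact hD'.isSet
          · rw [doneCount_congr fun j hj => by rw [hA j hj], hd]
        · refine .inl ⟨by omega, f13, hX₁.congr hi f16 fun x _ hx => ?_,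
            hX₂.congr hi h17 fun x _ _ => by rw [hm'], by omega⟩
          rw [hm']
          exact hm₂ x (by omega)
    split_ifs with h1 h2
    · exact absurd ⟨h1, h2⟩ hboth
    all_goals
      refine main _ (fun x hx h => ?_) ?_ rfl ?_ <;>
        simp (disch := omega) only [Cfg.reg_set_ne, Cfg.reg_set_self, Cfg.reg_tick, Cfg.clk_set,
          Cfg.clk_tick]
      omega

theorem wp_lockLoop (hw : Fits w n l) (E : Env n l α β M s) (hi : i < n)
    (hV : Closed (Conflict l α β M) n V) {m : ℕ}
    (hI : Running (Conflict l α β M) n l i V m s)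
    (hQ : ∀ s' k, (∀ x < 13, s'.reg x = s.reg x) → (∀ x < n * l + n, s'.mem x = s.mem x) →
      (Won (Conflict l α β M) n l i (m + k) s' ∨ Lost (Conflict l α β M) n (m + k) s') →
      s'.clk ≤ s.clk + k * (2 * (n * (32 * l + 64)) + 50) + 1 → Q s') :
    wp w lockLoop Q s := by
  unfold lockLoop
  -- A running state after `k` rounds has `m + k ≤ n`, hence `k < n + 1`.
  refine wp_whileNe (n + 1) (fun k s' => (∀ x < 13, s'.reg x = s.reg x) ∧
    (∀ x < n * l + n, s'.mem x = s.mem x) ∧ LockInv (Conflict l α β M) n l i V (m + k) s' ∧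
    s'.clk ≤ s.clk + k * (2 * (n * (32 * l + 64)) + 50)) ?_ ?_ ?_ ?_
  · rintro k s' ⟨hr, hm, h, hc⟩ hne
    rw [hr 5 (by omega), E.r5] at hne
    rcases h with h | h | h
    · have := h.le
      omega
    · exact absurd h.1 hne
    · exact absurd h.1 hne
  · rintro k s' ⟨hr, hm, h, hc⟩ hne
    rw [hr 5 (by omega), E.r5] at hne
    rcases h with h | h | h
    · refine wp_lockBody hw (E.frame (fun x hx => hr x (by omega)) fun x hx => hm x (by omega)) hi
        hV (m := m + k) h fun s₁ hr₁ hm₁ hI₁ hc₁ => ?_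
      refine ⟨fun x hx => (hr₁ x hx).trans (hr x hx), fun x hx => (hm₁ x hx).trans (hm x hx), hI₁,
        ?_⟩
      simp only [Cfg.clk_tick, Nat.succ_mul k] at hc₁ ⊢
      omega
    · exact absurd h.1 hne
    · exact absurd h.1 hne
  · rintro k s' ⟨hr, hm, h, hc⟩ he
    rw [hr 5 (by omega), E.r5] at he
    refine hQ _ k hr hm (h.resolve_left fun h => ?_) (by simp only [Cfg.clk_tick]; omega)
    have := h.1
    omega
  · exact ⟨fun _ _ => rfl, fun _ _ => rfl, .inl hI, by omega⟩

end Lock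

/-! ### The main loop and its amortized cost -/

/-- A bound on the time for one step of the propagation in both arrays. -/
def lockTime (n l : ℕ) : ℕ := 2 * (n * (32 * l + 64)) + 50

theorem wp_assign (hw : Fits w n l) (E : Env n l α β M s) {i : ℕ} (hi : i < n)
    (h12 : s.reg 12 = i) (h13 : s.reg 13 = 1)
    (hC : Closed (Conflict l α β M) n (arr (n * l) s.mem)) (hVi : arr (n * l) s.mem i = 2)
    (hV : ∀ j < i, arr (n * l) s.mem j < 2)
    (hQ : ∀ s' k, (∀ x < 13, s'.reg x = s.reg x) → (∀ x < n * l, s'.mem x = s.mem x) →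
      (s'.reg 13 = 1 ∧ Closed (Conflict l α β M) n (arr (n * l) s'.mem) ∧
        (∀ j ≤ i, arr (n * l) s'.mem j < 2) ∧
        doneCount n (arr (n * l) s'.mem) + 1 = doneCount n (arr (n * l) s.mem) + k ∨
       s'.reg 13 = 0 ∧ (¬ ∃ s, IsSolution (Conflict l α β M) n s) ∧
        doneCount n (arr (n * l) s.mem) + k ≤ n + 1) →
      s'.clk ≤ s.clk + k * lockTime n l + 21 * n + 20 → Q s') :
    wp w assign Q s := by
  have hw' := hw
  unfold Fits at hw'
  unfold assign
  simp (disch := omega) only [wp, Cfg.reg_set_ne, E.r7, E.r8]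
  refine wp_copyArr hw (E.frame (fun x hx => ?_) fun x _ => rfl) (a := n * l) (b := n * l + n)
    ?_ ?_ (by omega) (by omega) (by omega) (by omega) fun s₁ hr₁ hm₁ hA₁ hc₁ => ?_
  · simp (disch := omega) only [Cfg.reg_set_ne]
  · simp
  · simp
  simp only [Cfg.mem_set, Cfg.clk_set] at hm₁ hA₁ hc₁
  have hr₁' : ∀ x < 21, s₁.reg x = s.reg x := fun x hx => by
    rw [hr₁ x (by omega)]
    simp (disch := omega) only [Cfg.reg_set_ne]
  have e24 : s₁.reg 24 = n * l := by
    rw [hr₁ 24 (by omega)]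
    simp
  have E₁ : Env n l α β M s₁ := E.frame (fun x hx => hr₁' x (by omega))
    fun x hx => hm₁ x (by omega)
  rw [E₁.r9]
  refine wp_copyArr hw (E₁.frame (fun x hx => ?_) fun x _ => rfl) (a := n * l)
    (b := n * l + n + n) ?_ ?_ (by omega) (by omega) (by omega) (by omega)
    fun s₂ hr₂ hm₂ hA₂ hc₂ => ?_
  · simp (disch := omega) only [Cfg.reg_set_ne]
  · simpa using e24
  · simp
  simp only [Cfg.mem_set, Cfg.clk_set] at hm₂ hA₂ hc₂
  have hr₂' : ∀ x < 21, s₂.reg x = s.reg x := fun x hx => by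
    rw [hr₂ x (by omega)]
    simp (disch := omega) only [Cfg.reg_set_ne, hr₁']
  have hm : ∀ x < n * l + n, s₂.mem x = s.mem x := fun x hx =>
    (hm₂ x (by omega)).trans (hm₁ x (by omega))
  have hA₁' : ∀ j < n, s₂.mem (n * l + n + j) = arr (n * l) s.mem j := fun j hj =>
    (hm₂ _ (by omega)).trans (hA₁ j hj)
  have hA₂' : ∀ j < n, s₂.mem (n * l + n + n + j) = arr (n * l) s.mem j := fun j hj =>
    (hA₂ j hj).trans (hm₁ _ (by omega))
  have E₂ : Env n l α β M s₂ := E.frame (fun x hx => hr₂' x (by omega))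
    fun x hx => hm x (by omega)
  have e12 := (hr₂' 12 (by omega)).trans h12
  have e13 := (hr₂' 13 (by omega)).trans h13
  simp (disch := omega) only [Cfg.reg_set_self, Cfg.reg_set_ne, Cfg.reg_put, E₂.r8, E₂.r9, E₂.r10,
    E₂.r11, e12]
  refine ⟨by omega, by omega, by omega, by omega, by omega, ?_⟩
  refine wp_lockLoop hw (E₂.frame (fun x hx => ?_) fun x hx => ?_) hi hC
    (m := doneCount n (arr (n * l) s.mem)) ⟨?_, ?_, .inl ⟨?_, ?_, ?_⟩, .inl ⟨?_, ?_, ?_⟩, ?_⟩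
    fun s₃ k hr₃ hm₃ hp hc₃ => ?_
  · simp (disch := omega) only [Cfg.reg_set_ne, Cfg.reg_put]
  · simp (disch := omega) only [Cfg.mem_set, Cfg.mem_put, Function.update_of_ne]
  · simp
  · simp [e13]
  · simp
  · refine (hC.derived hVi hV (b := 0) (by omega)).congr hi fun j hj => ?_
    simp (disch := omega) only [Cfg.mem_set, Cfg.mem_put, arr, Function.update_of_ne]
    rcases eq_or_ne j i with rfl | hji
    · simp
    · simp (disch := omega) only [Function.update_of_ne, hA₁', arr]
  -- A pending code does not count as propagated, so both copies start with the count of the current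
  -- assignment.
  · rw [← doneCount_update_of_le (n := n) hVi.ge (show 2 ≤ 3 by omega)]
    refine doneCount_congr fun j hj => ?_
    simp (disch := omega) only [Cfg.mem_set, Cfg.mem_put, arr, Function.update_of_ne]
    rcases eq_or_ne j i with rfl | hji
    · simp
    · simp (disch := omega) only [Function.update_of_ne, hA₁', arr]
  · simp
  · refine (hC.derived hVi hV (b := 1) (by omega)).congr hi fun j hj => ?_
    simp only [Cfg.mem_set, Cfg.mem_put, arr_update]
    rcases eq_or_ne j i with rfl | hji
    · simp
    · simp (disch := omega) only [Function.update_of_ne, hA₂', arr]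
  · rw [← doneCount_update_of_le (n := n) hVi.ge (show 2 ≤ 4 by omega)]
    refine doneCount_congr fun j hj => ?_
    simp only [Cfg.mem_set, Cfg.mem_put, arr_update]
    rcases eq_or_ne j i with rfl | hji
    · simp
    · simp (disch := omega) only [Function.update_of_ne, hA₂', arr]
  · simp
  simp only [Cfg.mem_set, Cfg.mem_put, Cfg.clk_set, Cfg.clk_put] at hm₃ hc₃
  have hm₃' : ∀ x < n * l, s₃.mem x = s.mem x := fun x hx => by
    rw [hm₃ x (by omega)]
    simp (disch := omega) only [Function.update_of_ne, hm]
  have hr₃' : ∀ x < 13, s₃.reg x = s.reg x := fun x hx => by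
    rw [hr₃ x hx]
    simp (disch := omega) only [Cfg.reg_set_ne, Cfg.reg_put, hr₂']
  have E₃ : Env n l α β M s₃ := E.frame (fun x hx => hr₃' x (by omega)) hm₃'
  rw [E₃.r5]
  unfold lockTime at hQ
  rcases hp with ⟨-, g13, g15, hC', hset, hd⟩ | ⟨-, g13, hno, hk⟩
  · rw [if_pos g13]
    have e7 : s₃.tick.reg 7 = n * l := E₃.r7
    rw [e7]
    refine wp_copyArr hw (E₃.frame (fun x hx => ?_) fun x _ => rfl) (a := s₃.reg 15)
      (b := n * l) ?_ ?_ (by omega) (by omega) (by omega) (by omega) fun s₄ hr₄ hm₄ hA₄ hc₄ => ?_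
    · simp (disch := omega) only [Cfg.reg_set_ne, Cfg.reg_tick]
    · simp
    · simp
    simp only [Cfg.mem_set, Cfg.mem_tick, Cfg.clk_set, Cfg.clk_tick] at hm₄ hA₄ hc₄
    have hr₄' : ∀ x < 14, s₄.reg x = s₃.reg x := fun x hx => by
      rw [hr₄ x (by omega)]
      simp (disch := omega) only [Cfg.reg_set_ne, Cfg.reg_tick]
    have hC₄ := hC'.congr hA₄
    refine hQ s₄ k (fun x hx => (hr₄' x (by omega)).trans (hr₃' x hx))
      (fun x hx => (hm₄ x (by omega)).trans (hm₃' x hx))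
      (.inl ⟨(hr₄' 13 (by omega)).trans g13, hC₄, fun j hj => ?_, ?_⟩) (by omega)
    · have h1 := hC₄.code j (by omega)
      have h2 := hA₄ j (by omega)
      have h3 := hset j hj
      omega
    · rw [← hd, doneCount_congr fun j hj => by rw [hA₄ j hj]]
  · rw [if_neg (by omega)]
    refine hQ _ k hr₃' hm₃' (.inr ⟨g13, hno, hk⟩) ?_
    simp only [Cfg.clk_tick]
    omega

/-- The state of the main loop before the variable `k`: either the variables before `k` have values
that can be kept, or there is no solution. The last clause bounds the time in units of `X`. -/
def MainInv (K : ℕ → ℕ → ℕ → ℕ → Prop) (n l X k c : ℕ) (s : Cfg) : Prop :=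
  s.reg 13 = 1 ∧ Closed K n (arr (n * l) s.mem) ∧ (∀ j < k, arr (n * l) s.mem j < 2) ∧
      s.clk ≤ c + (2 * k + doneCount n (arr (n * l) s.mem)) * X ∨
    s.reg 13 = 0 ∧ (¬ ∃ s, IsSolution K n s) ∧ s.clk ≤ c + (2 * k + 2 * n) * X

/-- A unit of time for the main loop. -/
def unitTime (n l : ℕ) : ℕ := lockTime n l + 21 * n + 40

/-- Amortization: `k'` rounds are paid by the growth `k' - 1` of the count of propagated variables,
and the `2` units granted per variable cover the missing round and the copying. In case of failure,
the bound `n + 1` on count plus rounds suffices. -/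
theorem wp_mainBody (hw : Fits w n l) (E : Env n l α β M s) {k c : ℕ} (hk : k < n)
    (h12 : s.reg 12 = k) (hI : MainInv (Conflict l α β M) n l (unitTime n l) k c s)
    (hQ : ∀ s', (∀ x < 12, s'.reg x = s.reg x) → (∀ x < n * l, s'.mem x = s.mem x) →
      s'.reg 12 = k + 1 →
      MainInv (Conflict l α β M) n l (unitTime n l) (k + 1) c s'.tick → Q s') :
    wp w mainBody Q s.tick := by
  have hw' := hw
  unfold Fits at hw'
  have hX : unitTime n l = lockTime n l + 21 * n + 40 := rfl
  -- With the unit of time opaque, its multiples are atoms for linear arithmetic.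
  generalize hXe : unitTime n l = X at *
  unfold mainBody
  rw [wp]
  have fin : ∀ s₁ : Cfg, (∀ x < 13, s₁.reg x = s.reg x) → (∀ x < n * l, s₁.mem x = s.mem x) →
      MainInv (Conflict l α β M) n l X (k + 1) c s₁.tick.tick →
      wp w (.add 12 12 5) Q s₁ := by
    intro s₁ hr hm hI'
    have e12 := (hr 12 (by omega)).trans h12
    have e5 := (hr 5 (by omega)).trans E.r5
    rw [wp, e12, e5]
    refine ⟨by omega, hQ _ (fun x hx => ?_) hm (by simp) ?_⟩
    · simp (disch := omega) only [Cfg.reg_set_ne, hr]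
    · unfold MainInv at hI' ⊢
      simpa using hI'
  generalize wp w (.add 12 12 5) Q = R at fin ⊢
  rw [wp, Cfg.reg_tick, E.r5]
  have step2 : (2 * (k + 1) + 2 * n) * X = (2 * k + 2 * n) * X + 2 * X := by ring
  rcases hI with ⟨h13, hC, hlt, hc⟩ | ⟨h13, hno, hc⟩
  · rw [if_pos h13]
    simp (disch := omega) only [wp, Cfg.reg_set_self, Cfg.reg_set_ne, Cfg.reg_tick, Cfg.mem_set,
      Cfg.mem_tick, E.r6, E.r7, h12]
    have hv : s.mem (n * l + k) = arr (n * l) s.mem k := rfl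
    have step1 : ∀ d, (2 * (k + 1) + d) * X = (2 * k + d) * X + 2 * X := fun d => by ring
    refine ⟨by omega, ?_⟩
    split_ifs with h2
    · refine wp_assign hw (E.frame (fun x hx => ?_) fun _ _ => rfl) hk ?_ ?_ (by simpa using hC)
        h2 (by simpa using hlt) fun s₁ k' hr₁ hm₁ hp hc₁ => ?_
      · simp (disch := omega) only [Cfg.reg_set_ne, Cfg.reg_tick]
      · simp [h12]
      · simp [h13]
      simp only [Cfg.mem_set, Cfg.mem_tick, Cfg.clk_set, Cfg.clk_tick] at hm₁ hp hc₁
      have hkX : k' * lockTime n l ≤ k' * X := Nat.mul_le_mul_left _ (by omega)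
      have hr₁' : ∀ x < 13, s₁.reg x = s.reg x := fun x hx => by
        rw [hr₁ x hx]
        simp (disch := omega) only [Cfg.reg_set_ne, Cfg.reg_tick]
      refine fin s₁ hr₁' hm₁ ?_
      rcases hp with ⟨g13, hC', hset, hd⟩ | ⟨g13, hno, hk'⟩
      · refine .inl ⟨g13, hC', fun j hj => hset j (by omega), ?_⟩
        have : (2 * (k + 1) + doneCount n (arr (n * l) s₁.mem)) * X =
            (2 * k + doneCount n (arr (n * l) s.mem)) * X + (k' * X + X) := by
          rw [show 2 * (k + 1) + doneCount n (arr (n * l) s₁.mem) =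
            2 * k + doneCount n (arr (n * l) s.mem) + (k' + 1) by omega]
          ring
        simp only [Cfg.clk_tick, Cfg.mem_tick]
        omega
      · refine .inr ⟨g13, hno, ?_⟩
        have : (2 * k + doneCount n (arr (n * l) s.mem)) * X + (k' * X + X) ≤
            (2 * (k + 1) + 2 * n) * X := by
          calc _ = (2 * k + doneCount n (arr (n * l) s.mem) + k' + 1) * X := by ring
            _ ≤ _ := Nat.mul_le_mul_right _ (by omega)
        simp only [Cfg.clk_tick]
        omega
    · refine fin _ (fun x hx => ?_) (fun x _ => rfl) (.inl ⟨?_, ?_, fun j hj => ?_, ?_⟩)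
      · simp (disch := omega) only [Cfg.reg_set_ne, Cfg.reg_tick]
      · simp [h13]
      · simpa using hC
      · simp only [Cfg.mem_set, Cfg.mem_tick]
        rcases Nat.lt_succ_iff_lt_or_eq.1 hj with hj | rfl
        · exact hlt j hj
        · have := hC.code j hk
          omega
      · simp only [Cfg.mem_set, Cfg.mem_tick, Cfg.clk_set, Cfg.clk_tick, step1]
        omega
  · rw [if_neg (by omega)]
    refine fin _ (fun _ _ => rfl) (fun _ _ => rfl) (.inr ⟨h13, hno, ?_⟩)
    simp only [Cfg.clk_tick]
    omega

theorem wp_mainLoop (hw : Fits w n l) (E : Env n l α β M s) (h12 : s.reg 12 = 0)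
    (h13 : s.reg 13 = 1) (hV : ∀ j < n, arr (n * l) s.mem j = 2)
    (hQ : ∀ s', (s'.reg 13 = 1 ∧ (∃ s, IsSolution (Conflict l α β M) n s) ∨
      s'.reg 13 = 0 ∧ ¬ ∃ s, IsSolution (Conflict l α β M) n s) →
      s'.clk ≤ s.clk + 4 * n * unitTime n l + 1 → Q s') :
    wp w mainLoop Q s := by
  unfold mainLoop
  refine wp_whileNe n (fun k s' => k ≤ n ∧ (∀ x < 12, s'.reg x = s.reg x) ∧
    (∀ x < n * l, s'.mem x = s.mem x) ∧ s'.reg 12 = k ∧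
    MainInv (Conflict l α β M) n l (unitTime n l) k s.clk s') ?_ ?_ ?_ ?_
  · rintro k s' ⟨hk, hr, -, h, -⟩ hne
    rw [h, hr 0 (by omega), E.r0] at hne
    omega
  · rintro k s' ⟨hk, hr, hm, h, hI⟩ hne
    rw [h, hr 0 (by omega), E.r0] at hne
    refine wp_mainBody hw (E.frame hr hm) (by omega) h hI fun s₁ hr₁ hm₁ h₁ hI₁ => ?_
    exact ⟨by omega, fun x hx => (hr₁ x hx).trans (hr x hx),
      fun x hx => (hm₁ x hx).trans (hm x hx), h₁, hI₁⟩
  · rintro k s' ⟨hk, hr, hm, h, hI⟩ he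
    rw [h, hr 0 (by omega), E.r0] at he
    subst he
    have hX : (2 * k + 2 * k) * unitTime k l = 4 * k * unitTime k l := by ring
    rcases hI with ⟨g13, hC, hlt, hc⟩ | ⟨g13, hno, hc⟩
    · refine hQ _ (.inl ⟨g13, _, hC.isSolution hlt⟩) ?_
      have := Nat.mul_le_mul_right (unitTime k l)
        (Nat.add_le_add_left ((doneCount_le k (arr (k * l) s'.mem)).trans
          (Nat.le_mul_of_pos_left k (show 0 < 2 by omega))) (2 * k))
      simp only [Cfg.clk_tick]
      omega
    · refine hQ _ (.inr ⟨g13, hno⟩) ?_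
      simp only [Cfg.clk_tick]
      omega
  -- The empty assignment is closed, since it has no value to propagate.
  · refine ⟨by omega, fun _ _ => rfl, fun _ _ => rfl, h12, .inl ⟨h13, ⟨fun j hj => (hV j hj).le,
      fun p hp h => ?_⟩, by omega, by omega⟩⟩
    have := hV p hp
    omega

theorem wp_initLoop (hw : Fits w n l) (E : Env n l α β M s) (h21 : s.reg 21 = 0)
    (hQ : ∀ s', (∀ x < 21, s'.reg x = s.reg x) → (∀ x < n * l, s'.mem x = s.mem x) →
      (∀ j < n, arr (n * l) s'.mem j = 2) → s'.clk ≤ s.clk + 5 * n + 1 → Q s') :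
    wp w initLoop Q s := by
  unfold Fits at hw
  unfold initLoop
  refine wp_whileNe n (fun t s' => t ≤ n ∧ (∀ x < 21, s'.reg x = s.reg x) ∧
    (∀ x < n * l, s'.mem x = s.mem x) ∧ s'.reg 21 = t ∧ (∀ j < t, arr (n * l) s'.mem j = 2) ∧
    s'.clk ≤ s.clk + 5 * t) ?_ ?_ ?_ ?_
  · rintro t s' ⟨ht, hr, -, h, -⟩ hne
    rw [h, hr 0 (by omega), E.r0] at hne
    omega
  · rintro t s' ⟨ht, hr, hm, h, h2, hc⟩ hne
    rw [h, hr 0 (by omega), E.r0] at hne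
    have e5 := (hr 5 (by omega)).trans E.r5
    have e6 := (hr 6 (by omega)).trans E.r6
    have e7 := (hr 7 (by omega)).trans E.r7
    unfold initBody
    simp (disch := omega) only [wp, Cfg.reg_set_self, Cfg.reg_set_ne, Cfg.mem_set, Cfg.reg_tick,
      Cfg.mem_tick, Cfg.clk_tick, Cfg.clk_set, Cfg.reg_put, Cfg.mem_put, Cfg.clk_put, h, e5, e6, e7]
    refine ⟨by omega, by omega, by omega, fun x hx => ?_, fun x hx => ?_, trivial, fun j hj => ?_,
      by omega⟩
    · simp (disch := omega) only [Cfg.reg_set_ne, Cfg.reg_put, Cfg.reg_tick, hr]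
    · simp (disch := omega) only [Function.update_of_ne, hm]
    · rw [arr_update]
      rcases eq_or_ne j t with rfl | hjt
      · simp
      · rw [Function.update_of_ne hjt, h2 j (by omega)]
  · rintro t s' ⟨ht, hr, hm, h, h2, hc⟩ he
    rw [h, hr 0 (by omega), E.r0] at he
    subst he
    exact hQ _ hr hm h2 (by simp only [Cfg.clk_tick]; omega)
  · exact ⟨by omega, fun _ _ => rfl, fun _ _ => rfl, h21, by omega, le_rfl⟩

/-! ### Empty rows, the time bound and the word length -/

/-- All distances are `0` here, so only `α` can be violated, and only if two rows exist. This case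
must avoid the main loop, as the budget is constant when `ℓ = 0`. -/
theorem exists_isSolution_zero_iff :
    (∃ s, IsSolution (Conflict 0 α β M) n s) ↔ α = 0 ∨ n ≤ 1 := by
  constructor
  · rintro ⟨s, -, hs⟩
    by_contra! h
    refine hs 0 (by omega) 1 (by omega) (by omega) (.inl ?_)
    simpa [prefixDist] using Nat.pos_of_ne_zero h.1
  · intro h
    refine ⟨fun _ => 0, by simp, fun i hi j hj hji hc => ?_⟩
    simp only [Conflict, prefixDist, Finset.range_zero, Finset.sum_empty] at hc
    omega

/-- The left side equals `256 n²ℓ + 596 n² + 365 n + 19`. For `ℓ ≥ 1` the terms in `n²` and `n` are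
at most the same multiples of `n²ℓ`, so `2000` is a generous constant. -/
theorem time_le (hl : l ≠ 0) :
    4 * n * unitTime n l + 5 * n + 19 ≤ 2000 * (n ^ 2 * l + 1) := by
  rcases Nat.eq_zero_or_pos n with rfl | hn
  · simp
  obtain ⟨l, rfl⟩ := Nat.exists_eq_succ_of_ne_zero hl
  obtain ⟨n, rfl⟩ := Nat.exists_eq_succ_of_ne_zero hn.ne'
  simp only [unitTime, lockTime, Nat.succ_eq_add_one]
  ring_nf
  nlinarith [Nat.zero_le (n * l), Nat.zero_le (n ^ 2 * l)]

theorem wp_decideDMC (hw : Fits w n l) (h0 : s.reg 0 = n) (h1 : s.reg 1 = l) (h2 : s.reg 2 = α)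
    (h3 : s.reg 3 = β) (hM : ∀ x < n * l, s.mem x = M x) (hc : s.clk = 0) {out : ℕ}
    (hout : out = 1 ∧ (∃ s, IsSolution (Conflict l α β M) n s) ∨
      out = 0 ∧ ¬ ∃ s, IsSolution (Conflict l α β M) n s) :
    wp w decideDMC (fun s' => s'.clk ≤ 2000 * (n ^ 2 * l + 1) ∧ s'.reg 0 = out) s := by
  have hw' := hw
  unfold Fits at hw'
  unfold decideDMC
  simp (disch := omega) only [wp, Cfg.reg_set_self, Cfg.reg_set_ne, Cfg.reg_tick,
    h0, h1, h2]
  repeat refine ⟨by omega, ?_⟩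
  by_cases hl : l = 0
  · subst hl
    rw [exists_isSolution_zero_iff] at hout
    rw [if_pos rfl]
    simp only [Cfg.clk_set, Cfg.clk_tick]
    split_ifs <;> (repeat refine ⟨by omega, ?_⟩) <;> omega
  · rw [if_neg hl]
    have ht := time_le (n := n) hl
    refine ⟨by omega, ?_⟩
    refine wp_initLoop hw (α := α) (β := β) (M := M) ⟨?_, ?_, ?_, ?_, ?_, ?_, ?_, ?_, ?_, ?_, ?_,
      ?_, hM⟩ ?_ fun s₁ hr₁ hm₁ hA₁ hc₁ => ⟨by omega, ?_⟩
    any_goals simp (disch := omega) only [Cfg.reg_set_self, Cfg.reg_set_ne, Cfg.reg_tick, h0, h1,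
      h2, h3]
    refine wp_mainLoop hw (α := α) (β := β) (M := M) ⟨?_, ?_, ?_, ?_, ?_, ?_, ?_, ?_, ?_, ?_, ?_,
      ?_, fun x hx => (hm₁ x hx).trans (hM x hx)⟩ ?_ ?_ hA₁ fun s₂ hp hc₂ => ?_
    any_goals simp (disch := omega) only [Cfg.reg_set_self, Cfg.reg_set_ne, Cfg.reg_tick, hr₁, h0,
      h1, h2, h3]
    simp only [Cfg.clk_set, Cfg.clk_tick] at hc₁ hc₂ ⊢
    refine ⟨by omega, ?_⟩
    rcases hp with ⟨h, hp⟩ | ⟨h, hp⟩ <;> rcases hout with ⟨ho, ho'⟩ | ⟨ho, ho'⟩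
    · omega
    · exact absurd hp ho'
    · exact absurd ho' hp
    · omega

/-- The cube of `n + l + 2` exceeds every address and constant in use. The bounds `α` and `β` are
only compared, never used in arithmetic, so they impose no further condition. -/
theorem fits_of_pow_le (h : (n + l + α + β + 2) ^ 3 ≤ 2 ^ w) : Fits w n l := by
  refine lt_of_lt_of_le ?_
    ((Nat.pow_le_pow_left (show n + l + 2 ≤ n + l + α + β + 2 by omega) 3).trans h)
  ring_nf
  nlinarith [Nat.zero_le (n * l), Nat.zero_le (n ^ 2 * l), Nat.zero_le (n * l ^ 2)]

end DMC

/-- One word RAM program decides Diameter Matrix Completion with at most one missing entry per row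
in `O(n² ℓ)` steps (with `+ 1` for empty matrices), on every machine whose words have at least
`c * log₂ (n + ℓ + α + β + 2)` bits. -/
theorem mainTheorem4 :
    ∃ (P : WordRAM.Program) (C c : ℕ),
      ∀ (n l : ℕ) (S : DMC.IncompleteMatrix n l) (α β : ℕ),
        α ≤ β → DMC.MissingPerRowLE S 1 →
        ∀ w : ℕ, (n + l + α + β + 2) ^ c ≤ 2 ^ w →
          (DMC.IsYes S α β →
            WordRAM.HaltsWithin w P (DMC.initialState S α β) (C * (n ^ 2 * l + 1)) 1) ∧
          (¬ DMC.IsYes S α β →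
            WordRAM.HaltsWithin w P (DMC.initialState S α β) (C * (n ^ 2 * l + 1)) 0) := by
  refine ⟨DMC.decideDMC.compile 0, 2000, 3, fun n l S α β _ hS w hw => ?_⟩
  rw [DMC.isYes_iff S α β hS]
  exact ⟨fun h => WordRAM.haltsWithin_of_wp rfl (DMC.wp_decideDMC (M := DMC.inputMem S)
      (DMC.fits_of_pow_le hw) rfl rfl rfl rfl (fun _ _ => rfl) rfl (.inl ⟨rfl, h⟩)),
    fun h => WordRAM.haltsWithin_of_wp rfl (DMC.wp_decideDMC (M := DMC.inputMem S)
      (DMC.fits_of_pow_le hw) rfl rfl rfl rfl (fun _ _ => rfl) rfl (.inr ⟨rfl, h⟩))⟩
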